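/- Let $\alpha\in\mathbb{C}\setminus\{-1,-2,-3,\dots\}$ and let $p$ be a polynomial with complex coefficients; if $\alpha=0$, assume in addition that $p(0)=0$. **Finite part.** For $a\in\mathbb{C}\setminus\{0,-1,-2,\dots\}$, a function $g(t)=\sum_{n\ge0}g_nt^n$ analytic on a disk of radius larger than $\xi>0$ about $0$, put $$\mathrm{f.p.}\!\int_0^{\xi}t^{a-1}g(t)\,dt:=\xi^{a}\sum_{n=0}^\infty\frac{g_n}{n+a}\,\xi^n .$$ If $g$ is analytic at $0$ and $t^\alpha g(t)$ is integrable on $(\xi,\infty)$ for every $\xi>0$, put $$\mathrm{f.p.}\!\int_0^\infty t^\alpha g(t)\,dt:=\mathrm{f.p.}\!\int_0^\xi t^{\alpha}g(t)\,dt+\int_\xi^\infty t^\alpha g(t)\,dt,$$ where $\xi>0$ is any number such that $g$ is analytic on a disk of radius larger than $\xi$ about $0$, provided that the value does not depend on $\xi$. Here $t^\alpha=e^{\alpha\ln t}$ for $t>0$. **Riemann–Hilbert problem.** Find $f$ such that (i) $f$ is analytic on $\mathbb{C}\setminus[0,\infty)$ and for every $x>0$ the limits $f^{+}(x)=\lim_{z\to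 x,\ \mathrm{Im}\,z>0}f(z)$ and $f^{-}(x)=\lim_{z\to x,\ \mathrm{Im}\,z<0}f(z)$ exist; (ii) $f^+(x)=f^-(x)+p(x)x^\alpha e^{-x}$ for all $x>0$; (iii$_\infty$) $f(z)=O(z^{-1})$ as $z\to\infty$ in $\mathbb{C}\setminus[0,\infty)$; (iii$_0$) there is a function $f_0$ analytic at $0$ such that $f(z)-z^\alpha f_0(z)=O(1)$ as $z\to0$ in $\mathbb{C}\setminus[0,\infty)$, where $z^\alpha$ is the branch with $0<\arg z<2\pi$. **Theorem.** For every $z\in\mathbb{C}\setminus[0,\infty)$ the finite part $$\mathcal{C}_\alpha[p](z)=\frac1{2\pi i}\mathrm{f.p.}\!\int_0^\infty\frac{t^\alpha p(t)e^{-t}}{t-z}\,dt$$ is well defined (in particular independent of $\xi$), and $f=\mathcal{C}_\alpha[p]$ is the unique solution on $\mathbb{C}\setminus[0,\infty)$ of the Riemann–Hilbert problem (i)–(iii). -/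

import Mathlib

open scoped Topology Asymptotics

noncomputable section

/-- The operator `𝒥_a`: if `f(t) = ∑ fₙ tⁿ` near `0`, then `𝒥_a f (x) = ∑ fₙ / (n + a) xⁿ`.
Meaningful for `a ∉ {0, -1, -2, …}` and `x` inside a disk about `0` on which `f` is analytic. -/
def hadamardJ (a : ℂ) (f : ℂ → ℂ) (x : ℂ) : ℂ :=
  ∑' n : ℕ, (iteratedDeriv n f 0 / (n.factorial : ℂ)) / ((n : ℂ) + a) * x ^ n

/-- The Hadamard finite part of `∫₀ˣ t^(a-1) f(t) dt`, that is `x^a 𝒥_a f (x)`. -/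
def finitePartZero (a : ℂ) (f : ℂ → ℂ) (x : ℝ) : ℂ :=
  (x : ℂ) ^ a * hadamardJ a f (x : ℂ)

/-- `I` is the Hadamard finite part of `∫₀^∞ t^α f(t) dt`: `f` is analytic at `0` and, for *every*
`ξ > 0` such that `f` is analytic on a disk about `0` of radius larger than `ξ`, the tail integral
converges and `I = f.p.∫₀^ξ t^α f(t) dt + ∫_ξ^∞ t^α f(t) dt`. -/
def HasFinitePart (α : ℂ) (f : ℂ → ℂ) (I : ℂ) : Prop :=
  AnalyticAt ℂ f 0 ∧
  ∀ ξ : ℝ, 0 < ξ → (∃ r : ℝ, ξ < r ∧ DifferentiableOn ℂ f (Metric.ball 0 r)) →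
    MeasureTheory.IntegrableOn (fun t : ℝ => (t : ℂ) ^ α * f (t : ℂ)) (Set.Ioi ξ) ∧
    I = finitePartZero (α + 1) f ξ + ∫ t in Set.Ioi ξ, (t : ℂ) ^ α * f (t : ℂ)

theorem HasFinitePart.unique {α : ℂ} {f : ℂ → ℂ} {I J : ℂ}
    (hI : HasFinitePart α f I) (hJ : HasFinitePart α f J) : I = J := by
  obtain ⟨s, hs, hd⟩ := hI.1.exists_ball_analyticOnNhd
  have hξ : ∃ r : ℝ, s / 2 < r ∧ DifferentiableOn ℂ f (Metric.ball 0 r) :=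
    ⟨s, by linarith, hd.differentiableOn⟩
  rw [(hI.2 (s / 2) (by linarith) hξ).2, (hJ.2 (s / 2) (by linarith) hξ).2]

open Classical in
/-- The Hadamard finite part of `∫₀^∞ t^α f(t) dt` (and `0` if it does not exist). -/
def finitePart (α : ℂ) (f : ℂ → ℂ) : ℂ :=
  if h : ∃ I, HasFinitePart α f I then h.choose else 0

theorem HasFinitePart.finitePart_eq {α : ℂ} {f : ℂ → ℂ} {I : ℂ}
    (hI : HasFinitePart α f I) : finitePart α f = I := by
  have h : ∃ I, HasFinitePart α f I := ⟨I, hI⟩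
  rw [finitePart, dif_pos h]
  exact h.choose_spec.unique hI

/-- The integrand of the Cauchy transform without the factor `t^α`: `t ↦ p(t) e^{-t} / (t - z)`. -/
def cauchyKernel (p : Polynomial ℂ) (z : ℂ) (t : ℂ) : ℂ :=
  p.eval t * Complex.exp (-t) / (t - z)

/-- `𝒞_α[p](z) = (1 / 2πi) f.p.∫₀^∞ t^α p(t) e^{-t} / (t - z) dt`. -/
def cauchyTransform (α : ℂ) (p : Polynomial ℂ) (z : ℂ) : ℂ :=
  1 / (2 * (Real.pi : ℂ) * Complex.I) * finitePart α (cauchyKernel p z)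

/-- The domain `ℂ \ [0, ∞)`. -/
def cutPlane : Set ℂ := ((fun x : ℝ => (x : ℂ)) '' Set.Ici 0)ᶜ

/-- The branch of `z^α` on `ℂ \ [0, ∞)` with `0 < arg z < 2π`, i.e. `log z = log(-z) + πi` with
the principal logarithm of `-z`. -/
def cutPow (α z : ℂ) : ℂ :=
  Complex.exp (α * (Complex.log (-z) + (Real.pi : ℂ) * Complex.I))

/-- `f` solves the Riemann–Hilbert problem on `(0, ∞)` with jump `p(x) x^α e^{-x}`. -/
structure IsRHSolution (α : ℂ) (p : Polynomial ℂ) (f : ℂ → ℂ) : Prop where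
  analytic : AnalyticOnNhd ℂ f cutPlane
  /-- The boundary values from above and below exist and satisfy the jump relation. -/
  jump : ∀ x : ℝ, 0 < x → ∃ fp fm : ℂ,
    Filter.Tendsto f (𝓝[{z : ℂ | 0 < z.im}] (x : ℂ)) (𝓝 fp) ∧
    Filter.Tendsto f (𝓝[{z : ℂ | z.im < 0}] (x : ℂ)) (𝓝 fm) ∧
    fp = fm + p.eval (x : ℂ) * (x : ℂ) ^ α * Complex.exp (-(x : ℂ))
  /-- `f(z) = O(z⁻¹)` as `z → ∞`. -/
  at_infinity : f =O[Bornology.cobounded ℂ ⊓ Filter.principal cutPlane] (fun z : ℂ => z⁻¹)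
  /-- `f(z) = z^α 𝒪₀ + O(1)` as `z → 0`. -/
  at_zero : ∃ f₀ : ℂ → ℂ, AnalyticAt ℂ f₀ 0 ∧
    (fun z : ℂ => f z - cutPow α z * f₀ z) =O[𝓝[cutPlane] 0] (fun _ : ℂ => (1 : ℝ))

end

open MeasureTheory Set Filter

/-! Write `C_α[p]` for the finite part of the Cauchy integral without the factor `1/(2πi)`. Finite
parts obey the rules of ordinary integrals: they are linear, a factor `t` raises the exponent by
one, and the finite part of a derivative is zero (`finitePart_deriv`). Hence every admissible
exponent can be reduced to one with `Re α ≥ 1`, where the integral converges absolutely and its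
density is bounded and Lipschitz.

The reduction is the identity `t/(t-z) = 1 + z/(t-z)`, which gives `C_α[p](z) = (C_{α+1}[p](z) -
M)/z` with `M` independent of `z` (`cauchyIntegral_eq_div`). Analyticity, the Plemelj jump and
boundedness at infinity descend through it. One more use of it turns boundedness into decay like
`1/z`.

Near `0` this division would create poles, so integration by parts replaces it: `(α+1) C_α[p] =
C_{α+1}[p]' - C_{α+1}[p'-p]` preserves the shape `z^α f₀ + E` with `f₀` and `E` analytic. For
non-integral `α` with `Re α ≥ 1` that shape holds because a multiple of `z^α p(z) e^{-z}` has the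
same jump as `C_α[p]`, so their difference is entire (`exists_local_form_of_re`). Admissible
integers are nonnegative; there `C_α[p]` is bounded near `0`, using `p(0) = 0` when `α = 0`.

For uniqueness, the difference of two solutions has no jump. If `Re α < 0`, comparing the two sides
of the cut shows that `z^α f₀` is bounded on the positive axis, hence near `0`. The difference
therefore extends to an entire function vanishing at infinity, and Liouville's theorem finishes
(`eqOn_zero_of_boundary_eq`). -/

/-! ### Taylor series and the finite part on a bounded interval -/

/-- The Taylor coefficients of `f` at `0`. -/
noncomputable def taylorCoeff (f : ℂ → ℂ) (n : ℕ) : ℂ := iteratedDeriv n f 0 / (n.factorial : ℂ)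

theorem hadamardJ_eq (a : ℂ) (f : ℂ → ℂ) (x : ℂ) :
    hadamardJ a f x = ∑' n : ℕ, taylorCoeff f n / ((n : ℂ) + a) * x ^ n := rfl

theorem hasSum_taylorCoeff {f : ℂ → ℂ} {r : ℝ} (hf : DifferentiableOn ℂ f (Metric.ball 0 r))
    {z : ℂ} (hz : ‖z‖ < r) : HasSum (fun n => taylorCoeff f n * z ^ n) (f z) := by
  have h := Complex.hasSum_taylorSeries_on_ball hf (z := z) (by simpa using hz)
  refine h.congr_fun fun n => ?_
  rw [taylorCoeff, sub_zero, smul_eq_mul, smul_eq_mul]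
  ring

theorem summable_taylorCoeff_div {f : ℂ → ℂ} {r : ℝ}
    (hf : DifferentiableOn ℂ f (Metric.ball 0 r)) (a : ℂ) {z : ℂ} (hz : ‖z‖ < r) :
    Summable (fun n : ℕ => taylorCoeff f n / ((n : ℂ) + a) * z ^ n) := by
  have h := (hasSum_taylorCoeff hf hz).summable.norm
  refine Summable.of_norm_bounded_eventually_nat h ?_
  -- From this index on `|n + a| ≥ 1`, so the division only shrinks the terms; a vanishing
  -- denominator earlier on is harmless.
  filter_upwards [eventually_ge_atTop (⌈‖a‖⌉₊ + 1)] with n hn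
  have h1 : (1 : ℝ) ≤ ‖(n : ℂ) + a‖ := by
    have h2 : ‖(n : ℂ)‖ - ‖a‖ ≤ ‖(n : ℂ) + a‖ := by
      have := norm_sub_norm_le (n : ℂ) (-a)
      simpa using this
    have h3 : ‖a‖ ≤ ⌈‖a‖⌉₊ := Nat.le_ceil _
    have h4 : ((⌈‖a‖⌉₊ : ℝ) + 1) ≤ n := by exact_mod_cast hn
    rw [Complex.norm_natCast] at h2
    linarith
  rw [norm_mul, norm_mul, norm_div]
  gcongr
  exact div_le_self (norm_nonneg _) h1

theorem cast_add_ne_zero {α : ℂ} (hα : ∀ n : ℕ, α ≠ -((n : ℂ) + 1)) (n : ℕ) :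
    (n : ℂ) + (α + 1) ≠ 0 := fun h => hα n (by linear_combination h)

theorem finitePartZero_zero {a : ℂ} (ha : a ≠ 0) (f : ℂ → ℂ) : finitePartZero a f 0 = 0 := by
  simp [finitePartZero, Complex.zero_cpow ha]

/-- Away from the origin (or up to it, if the singularity is integrable) the finite part is a
primitive of the integrand. -/
theorem integral_eq_finitePartZero_sub {α : ℂ} (hα : ∀ n : ℕ, α ≠ -((n : ℂ) + 1)) {f : ℂ → ℂ}
    {r : ℝ} (hf : DifferentiableOn ℂ f (Metric.ball 0 r)) {x y : ℝ} (hx : 0 ≤ x) (hxy : x ≤ y)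
    (hy : y < r) (h : -1 < α.re ∨ 0 < x) :
    ∫ t in x..y, (t : ℂ) ^ α * f t = finitePartZero (α + 1) f y - finitePartZero (α + 1) f x := by
  have hna := cast_add_ne_zero hα
  have hy0 : 0 ≤ y := hx.trans hxy
  have hint : IntervalIntegrable (fun t : ℝ => (t : ℂ) ^ α) volume x y := by
    rcases h with h | h
    · exact intervalIntegral.intervalIntegrable_cpow' h
    · refine intervalIntegral.intervalIntegrable_cpow (Or.inr ?_)
      rw [uIcc_of_le hxy]
      exact fun h' => h.not_ge h'.1
  have hS := (hasSum_taylorCoeff hf (z := (y : ℂ)) (by simpa [abs_of_nonneg hy0])).summable.norm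
  have hsum : HasSum (fun n : ℕ => ∫ t in x..y, taylorCoeff f n * (t : ℂ) ^ (α + n))
      (∫ t in x..y, (t : ℂ) ^ α * f t) := by
    -- Termwise integration, dominated by the absolutely convergent Taylor series at the right
    -- endpoint times `|t^α|`.
    refine intervalIntegral.hasSum_integral_of_dominated_convergence
      (fun n t => ‖taylorCoeff f n * (y : ℂ) ^ n‖ * ‖(t : ℂ) ^ α‖) ?_ ?_ ?_ ?_ ?_
    · intro n
      refine Measurable.aestronglyMeasurable ?_
      fun_prop
    · intro n
      refine ae_of_all _ fun t ht => ?_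
      rw [uIoc_of_le hxy] at ht
      have ht0 : 0 < t := hx.trans_lt ht.1
      rw [Complex.cpow_add _ _ (by exact_mod_cast ht0.ne'), Complex.cpow_natCast, norm_mul,
        norm_mul, norm_mul, norm_pow, norm_pow, mul_comm ‖(t : ℂ) ^ α‖, mul_assoc]
      gcongr
      simpa [abs_of_nonneg hy0, abs_of_nonneg ht0.le] using ht.2
    · exact ae_of_all _ fun t _ => hS.mul_right _
    · simp_rw [tsum_mul_right]
      exact hint.norm.const_mul _
    · refine ae_of_all _ fun t ht => ?_
      rw [uIoc_of_le hxy] at ht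
      have ht0 : 0 < t := hx.trans_lt ht.1
      have := (hasSum_taylorCoeff hf (z := (t : ℂ))
        (by simpa [abs_of_nonneg ht0.le] using ht.2.trans_lt hy)).mul_left ((t : ℂ) ^ α)
      refine this.congr_fun fun n => ?_
      rw [Complex.cpow_add _ _ (by exact_mod_cast ht0.ne'), Complex.cpow_natCast]
      ring
  have key : ∀ s : ℝ, 0 ≤ s → s < r → HasSum
      (fun n : ℕ => taylorCoeff f n / ((n : ℂ) + (α + 1)) * (s : ℂ) ^ (α + n + 1))
      (finitePartZero (α + 1) f s) := by
    intro s hs hsr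
    have := (summable_taylorCoeff_div hf (α + 1) (z := (s : ℂ))
      (by simpa [abs_of_nonneg hs])).hasSum.mul_left ((s : ℂ) ^ (α + 1))
    rw [finitePartZero, hadamardJ_eq]
    refine this.congr_fun fun n => ?_
    rcases hs.eq_or_lt with rfl | hs
    · have h1 : α + 1 ≠ 0 := by simpa using hna 0
      have h2 : α + n + 1 ≠ 0 := by convert hna n using 1; ring
      simp [Complex.zero_cpow h1, Complex.zero_cpow h2]
    · have hs' : (s : ℂ) ≠ 0 := by exact_mod_cast hs.ne'
      rw [show α + n + 1 = (α + 1) + n by ring, Complex.cpow_add _ _ hs', Complex.cpow_natCast]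
      ring
  refine hsum.unique (((key y hy0 hy).sub (key x hx (hxy.trans_lt hy))).congr_fun fun n => ?_)
  rw [intervalIntegral.integral_const_mul, integral_cpow]
  · rw [show (n : ℂ) + (α + 1) = α + n + 1 by ring]
    ring
  · rcases h with h | h
    · left
      simp only [Complex.add_re, Complex.natCast_re]
      nlinarith [Nat.cast_nonneg (α := ℝ) n]
    · right
      refine ⟨fun h' => hna n (by linear_combination h'), ?_⟩
      rw [uIcc_of_le hxy]
      exact fun h' => h.not_ge h'.1

/-! ### Existence of the finite part on the half-line -/

/-- `f` is analytic at `0` and `t^α f(t)` is integrable at infinity. -/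
structure FinitePartIntegrable (α : ℂ) (f : ℂ → ℂ) : Prop where
  analyticAt : AnalyticAt ℂ f 0
  integrableOn : ∀ ξ : ℝ, 0 < ξ → IntegrableOn (fun t : ℝ => (t : ℂ) ^ α * f t) (Ioi ξ)

/-- Moving the cutoff from `x` to `y` adds to the head exactly the integral over `[x, y]` that the
tail loses, so the sum does not depend on the cutoff. -/
theorem FinitePartIntegrable.exists_hasFinitePart {α : ℂ} (hα : ∀ n : ℕ, α ≠ -((n : ℂ) + 1))
    {f : ℂ → ℂ} (hf : FinitePartIntegrable α f) : ∃ I, HasFinitePart α f I := by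
  obtain ⟨s, hs, hd⟩ := hf.1.exists_ball_analyticOnNhd
  have key : ∀ x y r : ℝ, 0 < x → x ≤ y → y < r → DifferentiableOn ℂ f (Metric.ball 0 r) →
      finitePartZero (α + 1) f x + ∫ t in Ioi x, (t : ℂ) ^ α * f t =
      finitePartZero (α + 1) f y + ∫ t in Ioi y, (t : ℂ) ^ α * f t := by
    intro x y r hx hxy hyr hr
    have h1 := integral_eq_finitePartZero_sub hα hr hx.le hxy hyr (Or.inr hx)
    have h2 := intervalIntegral.integral_Ioi_sub_Ioi (hf.2 x hx) hxy
    linear_combination h2 + h1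
  refine ⟨finitePartZero (α + 1) f (s / 2) + ∫ t in Ioi (s / 2), (t : ℂ) ^ α * f t, hf.1,
    fun ξ hξ ⟨r, hξr, hr⟩ => ⟨hf.2 ξ hξ, ?_⟩⟩
  rcases le_total ξ (s / 2) with h | h
  · exact (key ξ (s / 2) s hξ h (by linarith) hd.differentiableOn).symm
  · exact key (s / 2) ξ r (by linarith) h hξr hr

theorem FinitePartIntegrable.hasFinitePart {α : ℂ} (hα : ∀ n : ℕ, α ≠ -((n : ℂ) + 1))
    {f : ℂ → ℂ} (hf : FinitePartIntegrable α f) : HasFinitePart α f (finitePart α f) := by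
  obtain ⟨I, hI⟩ := hf.exists_hasFinitePart hα
  rwa [hI.finitePart_eq]

/-- Identities between finite parts are later checked at one cutoff, small enough for all functions
involved. -/
theorem FinitePartIntegrable.eventually_eq {α : ℂ} (hα : ∀ n : ℕ, α ≠ -((n : ℂ) + 1))
    {f : ℂ → ℂ} (hf : FinitePartIntegrable α f) : ∀ᶠ ξ in 𝓝[>] (0 : ℝ),
    finitePart α f = finitePartZero (α + 1) f ξ + ∫ t in Ioi ξ, (t : ℂ) ^ α * f t := by
  obtain ⟨s, hs, hd⟩ := hf.1.exists_ball_analyticOnNhd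
  filter_upwards [Ioo_mem_nhdsGT hs] with ξ hξ
  exact ((hf.hasFinitePart hα).2 ξ hξ.1 ⟨s, hξ.2, hd.differentiableOn⟩).2

theorem finitePart_eq_integral {α : ℂ} (hα : -1 < α.re) {f : ℂ → ℂ} (hf : AnalyticAt ℂ f 0)
    (hi : IntegrableOn (fun t : ℝ => (t : ℂ) ^ α * f t) (Ioi 0)) :
    finitePart α f = ∫ t in Ioi (0 : ℝ), (t : ℂ) ^ α * f t := by
  have hα' : ∀ n : ℕ, α ≠ -((n : ℂ) + 1) := by
    rintro n rfl
    simp at hα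
    nlinarith [Nat.cast_nonneg (α := ℝ) n]
  have hF : FinitePartIntegrable α f := ⟨hf, fun ξ hξ => hi.mono_set (Ioi_subset_Ioi hξ.le)⟩
  obtain ⟨s, hs, hd⟩ := hf.exists_ball_analyticOnNhd
  obtain ⟨ξ, h1, h2⟩ := ((hF.eventually_eq hα').and (Ioo_mem_nhdsGT hs)).exists
  have h3 := integral_eq_finitePartZero_sub hα' hd.differentiableOn le_rfl h2.1.le h2.2 (Or.inl hα)
  rw [finitePartZero_zero (by simpa using cast_add_ne_zero hα' 0), sub_zero] at h3
  have h4 := intervalIntegral.integral_Ioi_sub_Ioi hi h2.1.le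
  rw [h1]
  linear_combination -h3 - h4

/-! ### Calculus of finite parts: linearity, shift of exponent, integration by parts -/

theorem taylorCoeff_congr {f g : ℂ → ℂ} (h : f =ᶠ[𝓝 0] g) : taylorCoeff f = taylorCoeff g := by
  funext n
  rw [taylorCoeff, taylorCoeff, h.iteratedDeriv_eq]

theorem finitePartZero_congr {f g : ℂ → ℂ} (h : f =ᶠ[𝓝 0] g) (a : ℂ) :
    finitePartZero a f = finitePartZero a g := by
  funext x
  simp_rw [finitePartZero, hadamardJ_eq, taylorCoeff_congr h]

theorem taylorCoeff_add {f g : ℂ → ℂ} (hf : AnalyticAt ℂ f 0) (hg : AnalyticAt ℂ g 0) (n : ℕ) :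
    taylorCoeff (fun t => f t + g t) n = taylorCoeff f n + taylorCoeff g n := by
  rw [taylorCoeff, iteratedDeriv_fun_add hf.contDiffAt hg.contDiffAt, add_div]
  rfl

theorem taylorCoeff_const_mul (c : ℂ) (f : ℂ → ℂ) (n : ℕ) :
    taylorCoeff (fun t => c * f t) n = c * taylorCoeff f n := by
  rw [taylorCoeff, iteratedDeriv_const_mul_field, mul_div_assoc]
  rfl

theorem taylorCoeff_id_mul_zero (f : ℂ → ℂ) : taylorCoeff (fun t => t * f t) 0 = 0 := by
  simp [taylorCoeff]

theorem taylorCoeff_id_mul_succ {f : ℂ → ℂ} (hf : AnalyticAt ℂ f 0) (n : ℕ) :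
    taylorCoeff (fun t => t * f t) (n + 1) = taylorCoeff f n := by
  have h := iteratedDeriv_mul (n := n + 1) (x := (0 : ℂ)) (f := fun t : ℂ => t) (g := f)
    contDiffAt_id hf.contDiffAt
  rw [taylorCoeff, show (fun t => t * f t) = (fun t : ℂ => t) * f from rfl, h,
    Finset.sum_eq_single 1]
  · simp only [iteratedDeriv_one, deriv_id'', Nat.choose_one_right, Nat.add_sub_cancel, mul_one]
    rw [taylorCoeff, Nat.factorial_succ]
    push_cast
    have h1 : (n : ℂ) + 1 ≠ 0 := by exact_mod_cast n.succ_ne_zero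
    field_simp
  · intro b _ hb
    rw [iteratedDeriv_fun_id_zero]
    simp [hb]
  · intro h
    simp at h

theorem taylorCoeff_deriv (f : ℂ → ℂ) (n : ℕ) :
    taylorCoeff (deriv f) n = ((n : ℂ) + 1) * taylorCoeff f (n + 1) := by
  rw [taylorCoeff, taylorCoeff, iteratedDeriv_succ', Nat.factorial_succ]
  push_cast
  have h1 : (n : ℂ) + 1 ≠ 0 := by exact_mod_cast n.succ_ne_zero
  field_simp

theorem eventually_differentiableOn_ball {f : ℂ → ℂ} (hf : AnalyticAt ℂ f 0) :
    ∀ᶠ ξ in 𝓝[>] (0 : ℝ), 0 < ξ ∧ ∃ r, ξ < r ∧ DifferentiableOn ℂ f (Metric.ball 0 r) := by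
  obtain ⟨s, hs, hd⟩ := hf.exists_ball_analyticOnNhd
  filter_upwards [Ioo_mem_nhdsGT hs] with ξ hξ
  exact ⟨hξ.1, s, hξ.2, hd.differentiableOn⟩

theorem finitePartZero_add (a : ℂ) {f g : ℂ → ℂ} (hf : AnalyticAt ℂ f 0) (hg : AnalyticAt ℂ g 0) :
    ∀ᶠ ξ in 𝓝[>] (0 : ℝ), finitePartZero a (fun t => f t + g t) ξ =
      finitePartZero a f ξ + finitePartZero a g ξ := by
  filter_upwards [eventually_differentiableOn_ball hf, eventually_differentiableOn_ball hg]
    with ξ ⟨hξ, r, hr, hf'⟩ ⟨_, s, hs, hg'⟩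
  simp_rw [finitePartZero, hadamardJ_eq, taylorCoeff_add hf hg]
  rw [← mul_add, ← Summable.tsum_add]
  · congr 2
    funext n
    ring
  · exact summable_taylorCoeff_div hf' a (by simpa [abs_of_pos hξ])
  · exact summable_taylorCoeff_div hg' a (by simpa [abs_of_pos hξ])

theorem finitePartZero_const_mul (a c : ℂ) (f : ℂ → ℂ) (ξ : ℝ) :
    finitePartZero a (fun t => c * f t) ξ = c * finitePartZero a f ξ := by
  simp_rw [finitePartZero, hadamardJ_eq, taylorCoeff_const_mul]
  rw [mul_left_comm c, ← tsum_mul_left (a := c)]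
  congr 2
  funext n
  ring

theorem finitePartZero_id_mul (a : ℂ) {f : ℂ → ℂ} (hf : AnalyticAt ℂ f 0) :
    ∀ᶠ ξ in 𝓝[>] (0 : ℝ), finitePartZero a (fun t => t * f t) ξ = finitePartZero (a + 1) f ξ := by
  have hg : AnalyticAt ℂ (fun t => t * f t) 0 := analyticAt_id.mul hf
  filter_upwards [eventually_differentiableOn_ball hg] with ξ ⟨hξ, s, hs, hg'⟩
  have hξ' : (ξ : ℂ) ≠ 0 := by exact_mod_cast hξ.ne'
  rw [finitePartZero, finitePartZero, hadamardJ_eq, hadamardJ_eq,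
    (summable_taylorCoeff_div hg' a (by simpa [abs_of_pos hξ])).tsum_eq_zero_add,
    taylorCoeff_id_mul_zero, Complex.cpow_add _ _ hξ', Complex.cpow_one, mul_assoc, ← tsum_mul_left]
  simp_rw [taylorCoeff_id_mul_succ hf]
  simp only [zero_div, zero_mul, zero_add]
  congr 2
  funext n
  push_cast
  rw [show (n : ℂ) + 1 + a = n + (a + 1) by ring, pow_succ]
  ring

/-- The integrand is the derivative of `t^a f(t)`. Termwise, the factor `n + a` it produces cancels
the denominator, so the endpoint `0` contributes nothing. -/
theorem finitePartZero_deriv {a : ℂ} (ha : ∀ n : ℕ, (n : ℂ) + a ≠ 0) {f : ℂ → ℂ}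
    (hf : AnalyticAt ℂ f 0) :
    ∀ᶠ ξ in 𝓝[>] (0 : ℝ), finitePartZero a (fun t => a * f t + t * deriv f t) ξ =
      (ξ : ℂ) ^ a * f ξ := by
  filter_upwards [eventually_differentiableOn_ball hf] with ξ ⟨hξ, s, hs, hf'⟩
  have h1 := (hasSum_taylorCoeff hf' (z := (ξ : ℂ)) (by simpa [abs_of_pos hξ])).tsum_eq
  rw [finitePartZero, hadamardJ_eq, ← h1]
  congr 2
  funext n
  rw [taylorCoeff_add (f := fun t => a * f t) (g := fun t => t * deriv f t)
    (analyticAt_const.mul hf) (analyticAt_id.mul hf.deriv), taylorCoeff_const_mul]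
  have h2 : taylorCoeff (fun t => t * deriv f t) n = n * taylorCoeff f n := by
    cases n with
    | zero => simp [taylorCoeff_id_mul_zero]
    | succ n =>
      rw [taylorCoeff_id_mul_succ hf.deriv, taylorCoeff_deriv]
      push_cast
      rfl
  rw [h2]
  have := ha n
  field_simp
  ring

namespace FinitePartIntegrable

variable {α : ℂ} {f g : ℂ → ℂ}

theorem add (hf : FinitePartIntegrable α f) (hg : FinitePartIntegrable α g) :
    FinitePartIntegrable α (fun t => f t + g t) where
  analyticAt := hf.1.fun_add hg.1
  integrableOn ξ hξ := by
    refine ((hf.2 ξ hξ).add (hg.2 ξ hξ)).congr_fun (fun t _ => ?_) measurableSet_Ioi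
    exact (mul_add _ _ _).symm

theorem const_mul (c : ℂ) (hf : FinitePartIntegrable α f) :
    FinitePartIntegrable α (fun t => c * f t) where
  analyticAt := analyticAt_const.mul hf.1
  integrableOn ξ hξ := by
    refine IntegrableOn.congr_fun (f := fun t : ℝ => c * ((t : ℂ) ^ α * f t))
      ((hf.2 ξ hξ).const_mul c) (fun t _ => ?_) measurableSet_Ioi
    exact mul_left_comm _ _ _

end FinitePartIntegrable

section

variable {α : ℂ} {f g : ℂ → ℂ}

theorem finitePart_add (hα : ∀ n : ℕ, α ≠ -((n : ℂ) + 1)) (hf : FinitePartIntegrable α f)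
    (hg : FinitePartIntegrable α g) :
    finitePart α (fun t => f t + g t) = finitePart α f + finitePart α g := by
  obtain ⟨ξ, h1, h2, h3, h4, hξ⟩ := (((hf.add hg).eventually_eq hα).and <|
    (hf.eventually_eq hα).and <| (hg.eventually_eq hα).and <|
    (finitePartZero_add (α + 1) hf.1 hg.1).and self_mem_nhdsWithin).exists
  have h5 := integral_add (hf.2 ξ hξ) (hg.2 ξ hξ)
  simp only [← mul_add] at h5
  rw [h1, h2, h3, h4, h5]
  ring

theorem finitePart_const_mul (hα : ∀ n : ℕ, α ≠ -((n : ℂ) + 1)) (c : ℂ)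
    (hf : FinitePartIntegrable α f) :
    finitePart α (fun t => c * f t) = c * finitePart α f := by
  obtain ⟨ξ, h1, h2⟩ := (((hf.const_mul c).eventually_eq hα).and (hf.eventually_eq hα)).exists
  rw [h1, h2, finitePartZero_const_mul, mul_add, ← integral_const_mul]
  congr 2
  funext t
  ring

/-- Only the germ at `0` and the values on the positive axis matter, so kernel identities may fail
at the pole `t = z`. -/
theorem finitePart_congr (hα : ∀ n : ℕ, α ≠ -((n : ℂ) + 1)) (hf : FinitePartIntegrable α f)
    (hg : FinitePartIntegrable α g) (h0 : f =ᶠ[𝓝 0] g) (h : ∀ t : ℝ, 0 < t → f t = g t) :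
    finitePart α f = finitePart α g := by
  obtain ⟨ξ, h1, h2, hξ⟩ := ((hf.eventually_eq hα).and
    ((hg.eventually_eq hα).and self_mem_nhdsWithin)).exists
  rw [h1, h2, finitePartZero_congr h0]
  congr 1
  refine setIntegral_congr_fun measurableSet_Ioi fun t ht => ?_
  rw [h t (lt_trans hξ ht)]

theorem finitePart_id_mul (hα : ∀ n : ℕ, α ≠ -((n : ℂ) + 1))
    (hf : FinitePartIntegrable (α + 1) f) (hg : FinitePartIntegrable α (fun t => t * f t)) :
    finitePart α (fun t => t * f t) = finitePart (α + 1) f := by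
  have hα' : ∀ n : ℕ, α + 1 ≠ -((n : ℂ) + 1) := fun n h =>
    hα (n + 1) (by push_cast; linear_combination h)
  obtain ⟨ξ, h1, h2, h3, hξ⟩ := ((hf.eventually_eq hα').and ((hg.eventually_eq hα).and
    ((finitePartZero_id_mul (α + 1) hf.1).and self_mem_nhdsWithin))).exists
  rw [h1, h2, h3]
  congr 1
  refine setIntegral_congr_fun measurableSet_Ioi fun t ht => ?_
  have ht' : (t : ℂ) ≠ 0 := by exact_mod_cast (lt_trans hξ ht).ne'
  rw [Complex.cpow_add _ _ ht', Complex.cpow_one]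
  ring

/-- The finite part of the integral of a derivative vanishes. -/
theorem finitePart_deriv (hα : ∀ n : ℕ, α ≠ -((n : ℂ) + 1))
    (hg : FinitePartIntegrable α (fun t => (α + 1) * f t + t * deriv f t))
    (hf : AnalyticAt ℂ f 0) (hd : ∀ t : ℝ, 0 < t → DifferentiableAt ℂ f t)
    (hlim : Tendsto (fun t : ℝ => (t : ℂ) ^ (α + 1) * f t) atTop (𝓝 0)) :
    finitePart α (fun t => (α + 1) * f t + t * deriv f t) = 0 := by
  obtain ⟨ξ, h1, h2, hξ⟩ := ((hg.eventually_eq hα).and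
    ((finitePartZero_deriv (cast_add_ne_zero hα) hf).and self_mem_nhdsWithin)).exists
  have hα0 : α + 1 ≠ 0 := by simpa using cast_add_ne_zero hα 0
  have h3 := integral_Ioi_of_hasDerivAt_of_tendsto' (a := ξ)
    (f := fun t : ℝ => (t : ℂ) ^ (α + 1) * f t)
    (f' := fun t : ℝ => (t : ℂ) ^ α * ((α + 1) * f t + t * deriv f t)) (m := 0) ?_ (hg.2 ξ hξ) hlim
  · rw [h1, h2, h3]
    ring
  · intro t ht
    have ht0 : 0 < t := lt_of_lt_of_le hξ ht
    have ht' : (t : ℂ) ≠ 0 := by exact_mod_cast ht0.ne'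
    have h4 := hasDerivAt_ofReal_cpow_const ht0.ne' hα0
    have h5 := (hd t ht0).hasDerivAt.comp_ofReal
    refine (h4.mul h5).congr_deriv ?_
    rw [add_sub_cancel_right, Complex.cpow_add _ _ ht', Complex.cpow_one]
    ring

end

/-! ### The cut plane and the decay of the weight -/

theorem mem_cutPlane_iff {z : ℂ} : z ∈ cutPlane ↔ -z ∈ Complex.slitPlane := by
  rw [Complex.mem_slitPlane_iff_not_le_zero, cutPlane, mem_compl_iff, not_iff_not,
    Complex.nonpos_iff, mem_image]
  constructor
  · rintro ⟨x, hx, rfl⟩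
    simpa using hx
  · rintro ⟨h1, h2⟩
    refine ⟨z.re, by simpa using h1, ?_⟩
    apply Complex.ext <;> simp_all

theorem isOpen_cutPlane : IsOpen cutPlane := by
  have : cutPlane = (fun z => -z) ⁻¹' Complex.slitPlane := by
    ext z
    exact mem_cutPlane_iff
  rw [this]
  exact Complex.isOpen_slitPlane.preimage continuous_neg

theorem ne_zero_of_mem_cutPlane {z : ℂ} (hz : z ∈ cutPlane) : z ≠ 0 := by
  rintro rfl
  simp [mem_cutPlane_iff] at hz

theorem mem_cutPlane_of_im_ne_zero {z : ℂ} (hz : z.im ≠ 0) : z ∈ cutPlane := by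
  rw [mem_cutPlane_iff, Complex.mem_slitPlane_iff]
  exact Or.inr (by simpa using hz)

theorem ofReal_ne_of_mem_cutPlane {z : ℂ} (hz : z ∈ cutPlane) {t : ℝ} (ht : 0 ≤ t) :
    (t : ℂ) ≠ z := by
  rintro rfl
  exact hz ⟨t, ht, rfl⟩

theorem exists_le_norm_sub {z : ℂ} (hz : z ∈ cutPlane) :
    ∃ δ : ℝ, 0 < δ ∧ ∀ t : ℝ, 0 ≤ t → ∀ w ∈ Metric.ball z δ, δ ≤ ‖(t : ℂ) - w‖ := by
  obtain ⟨ε, hε, h⟩ := Metric.isOpen_iff.1 isOpen_cutPlane z hz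
  refine ⟨ε / 2, by positivity, fun t ht w hw => ?_⟩
  have h1 : ε ≤ dist (t : ℂ) z := by
    by_contra! h'
    exact ofReal_ne_of_mem_cutPlane (h (show (t : ℂ) ∈ Metric.ball z ε from h')) ht rfl
  have h2 : dist (t : ℂ) z ≤ dist (t : ℂ) w + dist w z := dist_triangle _ _ _
  rw [Metric.mem_ball] at hw
  rw [← dist_eq_norm]
  linarith

theorem isBigO_cpow_mul_exp (α : ℂ) (p : Polynomial ℂ) :
    (fun t : ℝ => (t : ℂ) ^ α * (p.eval (t : ℂ) * Complex.exp (-t))) =O[atTop]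
      fun t => Real.exp (-(1 / 2) * t) := by
  induction p using Polynomial.induction_on' with
  | add p q hp hq =>
    refine (hp.add hq).congr_left fun t => ?_
    rw [Polynomial.eval_add]
    ring
  | monomial n a =>
    -- Half of the exponential decay absorbs the power of `t`; the other half remains.
    have h := ((isLittleO_rpow_exp_pos_mul_atTop (α.re + n)
      (b := 1 / 2) (by norm_num)).isBigO.const_mul_left ‖a‖).mul
      (Asymptotics.isBigO_refl (fun t : ℝ => Real.exp (-t)) atTop)
    refine Asymptotics.IsBigO.congr' (Asymptotics.IsBigO.of_norm_left
      (f' := fun t : ℝ => (t : ℂ) ^ α * ((Polynomial.monomial n a).eval (t : ℂ) *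
      Complex.exp (-t))) (h.congr' ?_ EventuallyEq.rfl)) EventuallyEq.rfl ?_
    · filter_upwards [eventually_gt_atTop 0] with t ht
      rw [Polynomial.eval_monomial, norm_mul, norm_mul, norm_mul, norm_pow,
        Complex.norm_cpow_eq_rpow_re_of_pos ht, Complex.norm_exp, Real.rpow_add ht,
        Real.rpow_natCast, Complex.norm_real, Real.norm_of_nonneg ht.le]
      simp only [Complex.neg_re, Complex.ofReal_re]
      ring
    · refine Eventually.of_forall fun t => ?_
      simp only
      rw [← Real.exp_add]
      congr 1
      ring

theorem tendsto_cpow_mul_exp (α : ℂ) (p : Polynomial ℂ) :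
    Tendsto (fun t : ℝ => (t : ℂ) ^ α * (p.eval (t : ℂ) * Complex.exp (-t))) atTop (𝓝 0) := by
  refine (isBigO_cpow_mul_exp α p).trans_tendsto ?_
  refine Real.tendsto_exp_atBot.comp ?_
  exact tendsto_id.const_mul_atTop_of_neg (by norm_num)

theorem continuous_weight (p : Polynomial ℂ) :
    Continuous (fun t : ℂ => p.eval t * Complex.exp (-t)) := by
  fun_prop

theorem continuousAt_ofReal_cpow_mul (α : ℂ) (p : Polynomial ℂ) {t : ℝ} (ht : 0 < t) :
    ContinuousAt (fun t : ℝ => (t : ℂ) ^ α * (p.eval (t : ℂ) * Complex.exp (-t))) t :=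
  (Complex.continuousAt_ofReal_cpow_const _ _ (Or.inr ht.ne')).mul
    ((continuous_weight p).comp Complex.continuous_ofReal).continuousAt

theorem measurable_cpow_mul_weight (α : ℂ) (p : Polynomial ℂ) :
    Measurable (fun t : ℝ => (t : ℂ) ^ α * (p.eval (t : ℂ) * Complex.exp (-t))) := by
  have := ((continuous_weight p).comp Complex.continuous_ofReal).measurable
  exact (by fun_prop : Measurable (fun t : ℝ => (t : ℂ) ^ α)).mul this

theorem integrableOn_Ioi_cpow_mul_exp (α : ℂ) (p : Polynomial ℂ) {ξ : ℝ} (hξ : 0 < ξ) :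
    IntegrableOn (fun t : ℝ => (t : ℂ) ^ α * (p.eval (t : ℂ) * Complex.exp (-t))) (Ioi ξ) := by
  rw [IntegrableOn, ← integrable_norm_iff (measurable_cpow_mul_weight α p).aestronglyMeasurable]
  refine integrable_of_isBigO_exp_neg (b := 1 / 2) (by norm_num) (fun t ht => ?_)
    (isBigO_cpow_mul_exp α p).norm_left
  exact (continuousAt_ofReal_cpow_mul α p (lt_of_lt_of_le hξ ht)).norm.continuousWithinAt

theorem integrableOn_Ioi_zero_cpow_mul_exp {α : ℂ} (hα : -1 < α.re) (p : Polynomial ℂ) :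
    IntegrableOn (fun t : ℝ => (t : ℂ) ^ α * (p.eval (t : ℂ) * Complex.exp (-t))) (Ioi 0) := by
  rw [← Ioc_union_Ioi_eq_Ioi (zero_le_one (α := ℝ)), integrableOn_union]
  refine ⟨?_, integrableOn_Ioi_cpow_mul_exp α p one_pos⟩
  rw [← intervalIntegrable_iff_integrableOn_Ioc_of_le zero_le_one]
  exact (intervalIntegral.intervalIntegrable_cpow' hα).mul_continuousOn
    ((continuous_weight p).comp Complex.continuous_ofReal).continuousOn

/-! ### Cauchy kernels and their recurrences -/

/-- `t ↦ p(t) e^{-t} / (t - z)^k`. -/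
noncomputable def cauchyKernelPow (p : Polynomial ℂ) (z : ℂ) (k : ℕ) (t : ℂ) : ℂ :=
  p.eval t * Complex.exp (-t) / (t - z) ^ k

theorem cauchyKernelPow_one (p : Polynomial ℂ) (z : ℂ) :
    cauchyKernelPow p z 1 = cauchyKernel p z := by
  funext t
  rw [cauchyKernelPow, cauchyKernel, pow_one]

theorem differentiableAt_cauchyKernelPow (p : Polynomial ℂ) {z t : ℂ} (k : ℕ) (h : t ≠ z) :
    DifferentiableAt ℂ (cauchyKernelPow p z k) t := by
  unfold cauchyKernelPow
  have : (t - z) ^ k ≠ 0 := pow_ne_zero _ (sub_ne_zero.2 h)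
  fun_prop (disch := assumption)

theorem analyticAt_cauchyKernelPow (p : Polynomial ℂ) {z t : ℂ} (k : ℕ) (h : t ≠ z) :
    AnalyticAt ℂ (cauchyKernelPow p z k) t := by
  rw [Complex.analyticAt_iff_eventually_differentiableAt]
  filter_upwards [isOpen_ne.mem_nhds h] with s hs
  exact differentiableAt_cauchyKernelPow p k hs

theorem integrableOn_cauchyKernelPow {α : ℂ} {p : Polynomial ℂ} {ξ : ℝ} (hξ : 0 ≤ ξ)
    (hi : IntegrableOn (fun t : ℝ => (t : ℂ) ^ α * (p.eval (t : ℂ) * Complex.exp (-t))) (Ioi ξ))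
    {z : ℂ} (hz : z ∈ cutPlane) (k : ℕ) :
    IntegrableOn (fun t : ℝ => (t : ℂ) ^ α * cauchyKernelPow p z k t) (Ioi ξ) := by
  obtain ⟨δ, hδ, h⟩ := exists_le_norm_sub hz
  have := Integrable.mul_bdd (g := fun t : ℝ => (((t : ℂ) - z) ^ k)⁻¹) (c := δ⁻¹ ^ k) hi ?_ ?_
  · refine IntegrableOn.congr_fun this (fun t _ => ?_) measurableSet_Ioi
    simp only [cauchyKernelPow]
    ring
  · refine Measurable.aestronglyMeasurable ?_
    fun_prop
  · filter_upwards [self_mem_ae_restrict measurableSet_Ioi] with t ht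
    rw [norm_inv, norm_pow, ← inv_pow]
    gcongr
    exact h t (hξ.trans (le_of_lt ht)) z (Metric.mem_ball_self hδ)

theorem finitePartIntegrable_cauchyKernelPow (α : ℂ) (p : Polynomial ℂ) {z : ℂ}
    (hz : z ∈ cutPlane) (k : ℕ) : FinitePartIntegrable α (cauchyKernelPow p z k) where
  analyticAt := analyticAt_cauchyKernelPow p k (ne_zero_of_mem_cutPlane hz).symm
  integrableOn _ hξ := integrableOn_cauchyKernelPow hξ.le (integrableOn_Ioi_cpow_mul_exp α p hξ) hz k

theorem finitePartIntegrable_cauchyKernel (α : ℂ) (p : Polynomial ℂ) {z : ℂ}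
    (hz : z ∈ cutPlane) : FinitePartIntegrable α (cauchyKernel p z) := by
  simpa only [cauchyKernelPow_one] using finitePartIntegrable_cauchyKernelPow α p hz 1

/-- The finite part of `∫₀^∞ t^α p(t) e^{-t} / (t - z)^k dt`. -/
noncomputable def cauchyIntegral (α : ℂ) (p : Polynomial ℂ) (k : ℕ) (z : ℂ) : ℂ :=
  finitePart α (cauchyKernelPow p z k)

theorem eventually_ne_nhds_zero {z : ℂ} (hz : z ∈ cutPlane) : ∀ᶠ t in 𝓝 (0 : ℂ), t ≠ z :=
  isOpen_ne.mem_nhds (ne_zero_of_mem_cutPlane hz).symm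

variable {α : ℂ}

theorem ne_neg_succ_add_one (hα : ∀ n : ℕ, α ≠ -((n : ℂ) + 1)) (n : ℕ) :
    α + 1 ≠ -((n : ℂ) + 1) := fun h => hα (n + 1) (by push_cast; linear_combination h)

theorem finitePartIntegrable_id_mul_cauchyKernelPow (α : ℂ) (p : Polynomial ℂ) {z : ℂ}
    (hz : z ∈ cutPlane) (k : ℕ) :
    FinitePartIntegrable α (fun t => t * cauchyKernelPow p z k t) := by
  have h := finitePartIntegrable_cauchyKernelPow α (Polynomial.X * p) hz k
  have h' : cauchyKernelPow (Polynomial.X * p) z k = fun t => t * cauchyKernelPow p z k t := by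
    funext t
    simp only [cauchyKernelPow, Polynomial.eval_mul, Polynomial.eval_X]
    ring
  rwa [h'] at h

theorem cauchyIntegral_X_mul (hα : ∀ n : ℕ, α ≠ -((n : ℂ) + 1)) (p : Polynomial ℂ) {z : ℂ}
    (hz : z ∈ cutPlane) (k : ℕ) :
    cauchyIntegral α (Polynomial.X * p) k z = cauchyIntegral (α + 1) p k z := by
  have h' : cauchyKernelPow (Polynomial.X * p) z k = fun t => t * cauchyKernelPow p z k t := by
    funext t
    simp only [cauchyKernelPow, Polynomial.eval_mul, Polynomial.eval_X]
    ring
  rw [cauchyIntegral, h', cauchyIntegral]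
  exact finitePart_id_mul hα (finitePartIntegrable_cauchyKernelPow _ p hz k)
    (finitePartIntegrable_id_mul_cauchyKernelPow α p hz k)

/-- Writing `t = (t - z) + z` in the numerator. The case `k = 0` lowers the exponent; `k = 1` is its
counterpart for the derivative in `z`. -/
theorem cauchyIntegral_add_one (hα : ∀ n : ℕ, α ≠ -((n : ℂ) + 1)) (p : Polynomial ℂ) {z : ℂ}
    (hz : z ∈ cutPlane) (k : ℕ) :
    cauchyIntegral (α + 1) p (k + 1) z =
      cauchyIntegral α p k z + z * cauchyIntegral α p (k + 1) z := by
  have F := fun k => finitePartIntegrable_cauchyKernelPow α p hz k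
  have G := finitePartIntegrable_id_mul_cauchyKernelPow α p hz (k + 1)
  rw [cauchyIntegral, cauchyIntegral, cauchyIntegral, ← finitePart_const_mul hα _ (F (k + 1)),
    ← finitePart_add hα (F k) ((F (k + 1)).const_mul z),
    ← finitePart_id_mul hα (finitePartIntegrable_cauchyKernelPow _ p hz _) G]
  have key : ∀ t : ℂ, t ≠ z → t * cauchyKernelPow p z (k + 1) t =
      cauchyKernelPow p z k t + z * cauchyKernelPow p z (k + 1) t := by
    intro t ht
    have : t - z ≠ 0 := sub_ne_zero.2 ht
    simp only [cauchyKernelPow, pow_succ]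
    field_simp
    ring
  refine finitePart_congr hα G ((F k).add ((F (k + 1)).const_mul z)) ?_ fun t ht =>
    key t (ofReal_ne_of_mem_cutPlane hz ht.le)
  filter_upwards [eventually_ne_nhds_zero hz] with t ht using key t ht

theorem cauchyIntegral_zero (p : Polynomial ℂ) (z : ℂ) :
    cauchyIntegral α p 0 z = finitePart α (fun t => p.eval t * Complex.exp (-t)) := by
  rw [cauchyIntegral]
  congr 1
  funext t
  rw [cauchyKernelPow, pow_zero, div_one]

/-- Integration by parts applied to `t^(α+1) p(t) e^{-t} / (t - z)`. As the kernel with `k = 2` is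
the `z`-derivative of the one with `k = 1`, this recovers exponent `α` from exponent `α + 1` without
dividing by `z`. -/
theorem add_one_mul_cauchyIntegral (hα : ∀ n : ℕ, α ≠ -((n : ℂ) + 1)) (p : Polynomial ℂ) {z : ℂ}
    (hz : z ∈ cutPlane) :
    (α + 1) * cauchyIntegral α p 1 z = cauchyIntegral (α + 1) p 2 z -
      cauchyIntegral (α + 1) (p.derivative - p) 1 z := by
  have F := finitePartIntegrable_cauchyKernelPow α p hz 1
  have G := finitePartIntegrable_id_mul_cauchyKernelPow α p hz 2
  have G' := finitePartIntegrable_id_mul_cauchyKernelPow α (p.derivative - p) hz 1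
  have hderiv : ∀ t : ℂ, t ≠ z → deriv (cauchyKernelPow p z 1) t =
      cauchyKernelPow (p.derivative - p) z 1 t + (-1) * cauchyKernelPow p z 2 t := by
    intro t ht
    have ht' : t - z ≠ 0 := sub_ne_zero.2 ht
    have h1 : HasDerivAt (fun t : ℂ => Complex.exp (-t)) (-Complex.exp (-t)) t := by
      simpa using (hasDerivAt_neg t).cexp
    have h2 := ((p.hasDerivAt t).fun_mul h1).fun_div ((hasDerivAt_id t).sub_const z) ht'
    have h3 : cauchyKernelPow p z 1 = fun t => p.eval t * Complex.exp (-t) / (t - z) := by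
      funext t
      rw [cauchyKernelPow, pow_one]
    rw [h3]
    refine h2.deriv.trans ?_
    simp only [cauchyKernelPow, Polynomial.eval_sub, id]
    field_simp
    ring
  have S := (F.const_mul (α + 1)).add (G'.add (G.const_mul (-1)))
  have heq : ∀ t : ℂ, t ≠ z → (α + 1) * cauchyKernelPow p z 1 t +
      t * deriv (cauchyKernelPow p z 1) t = (α + 1) * cauchyKernelPow p z 1 t +
      (t * cauchyKernelPow (p.derivative - p) z 1 t + (-1) * (t * cauchyKernelPow p z 2 t)) := by
    intro t ht
    rw [hderiv t ht]
    ring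
  have heq0 : (fun t => (α + 1) * cauchyKernelPow p z 1 t +
      t * deriv (cauchyKernelPow p z 1) t) =ᶠ[𝓝 0] fun t => (α + 1) * cauchyKernelPow p z 1 t +
      (t * cauchyKernelPow (p.derivative - p) z 1 t + (-1) * (t * cauchyKernelPow p z 2 t)) := by
    filter_upwards [eventually_ne_nhds_zero hz] with t ht using heq t ht
  have D : FinitePartIntegrable α (fun t => (α + 1) * cauchyKernelPow p z 1 t +
      t * deriv (cauchyKernelPow p z 1) t) := by
    refine ⟨S.1.congr heq0.symm, fun ξ hξ => (S.2 ξ hξ).congr_fun (fun t ht => ?_)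
      measurableSet_Ioi⟩
    simp only
    rw [heq t (ofReal_ne_of_mem_cutPlane hz (hξ.trans ht).le)]
  have h0 := finitePart_deriv hα D F.1
    (fun t ht => differentiableAt_cauchyKernelPow p 1 (ofReal_ne_of_mem_cutPlane hz ht.le)) ?_
  · rw [finitePart_congr hα D S heq0 fun t ht => heq t (ofReal_ne_of_mem_cutPlane hz ht.le),
      finitePart_add hα (F.const_mul _) (G'.add (G.const_mul _)),
      finitePart_add hα G' (G.const_mul _), finitePart_const_mul hα _ F,
      finitePart_const_mul hα _ G,
      finitePart_id_mul hα (finitePartIntegrable_cauchyKernelPow _ _ hz _) G,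
      finitePart_id_mul hα (finitePartIntegrable_cauchyKernelPow _ _ hz _) G'] at h0
    simp only [cauchyIntegral]
    linear_combination h0
  · obtain ⟨δ, hδ, h⟩ := exists_le_norm_sub hz
    have h1 := (tendsto_cpow_mul_exp (α + 1) p).norm.mul_const δ⁻¹
    rw [norm_zero, zero_mul] at h1
    refine squeeze_zero_norm' ?_ h1
    filter_upwards [eventually_gt_atTop 0] with t ht
    rw [cauchyKernelPow, pow_one, mul_div_assoc', norm_div, div_eq_mul_inv]
    gcongr
    exact h t ht.le z (Metric.mem_ball_self hδ)

/-! ### Analyticity in `z` -/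

theorem cauchyIntegral_eq_integral (hα : -1 < α.re) (p : Polynomial ℂ) {z : ℂ}
    (hz : z ∈ cutPlane) (k : ℕ) :
    cauchyIntegral α p k z = ∫ t in Ioi (0 : ℝ), (t : ℂ) ^ α * cauchyKernelPow p z k t :=
  finitePart_eq_integral hα (finitePartIntegrable_cauchyKernelPow α p hz k).1
    (integrableOn_cauchyKernelPow le_rfl (integrableOn_Ioi_zero_cpow_mul_exp hα p) hz k)

theorem hasDerivAt_cauchyIntegral_of_re (hα : -1 < α.re) (p : Polynomial ℂ) {z : ℂ}
    (hz : z ∈ cutPlane) :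
    HasDerivAt (cauchyIntegral α p 1) (cauchyIntegral α p 2 z) z := by
  obtain ⟨δ, hδ, h⟩ := exists_le_norm_sub hz
  have hi := integrableOn_Ioi_zero_cpow_mul_exp hα p
  have hmeas : ∀ w k, AEStronglyMeasurable (fun t : ℝ => (t : ℂ) ^ α * cauchyKernelPow p w k t)
      (volume.restrict (Ioi 0)) := by
    intro w k
    have h1 : Measurable (fun t : ℝ => (((t : ℂ) - w) ^ k)⁻¹) := by fun_prop
    refine (((measurable_cpow_mul_weight α p).mul h1).aestronglyMeasurable).congr ?_
    refine ae_of_all _ fun t => ?_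
    simp only [cauchyKernelPow, Pi.mul_apply]
    ring
  have hnhds : ∀ᶠ w in 𝓝 z, w ∈ cutPlane := isOpen_cutPlane.mem_nhds hz
  have key := hasDerivAt_integral_of_dominated_loc_of_deriv_le (μ := volume.restrict (Ioi 0))
    (F := fun w (t : ℝ) => (t : ℂ) ^ α * cauchyKernelPow p w 1 t)
    (F' := fun w (t : ℝ) => (t : ℂ) ^ α * cauchyKernelPow p w 2 t) (x₀ := z)
    (s := Metric.ball z δ)
    (bound := fun t : ℝ => ‖(t : ℂ) ^ α * (p.eval (t : ℂ) * Complex.exp (-t))‖ * (δ ^ 2)⁻¹)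
    (Metric.ball_mem_nhds z hδ) (Eventually.of_forall fun w => hmeas w 1)
    (integrableOn_cauchyKernelPow le_rfl hi hz 1) (hmeas z 2) ?_ (hi.norm.mul_const _) ?_
  · rw [cauchyIntegral_eq_integral hα p hz]
    refine key.2.congr_of_eventuallyEq ?_
    filter_upwards [hnhds] with w hw using cauchyIntegral_eq_integral hα p hw 1
  · filter_upwards [self_mem_ae_restrict measurableSet_Ioi] with t ht w hw
    rw [cauchyKernelPow, mul_div_assoc', norm_div, norm_pow, div_eq_mul_inv]
    gcongr
    exact h t (le_of_lt ht) w hw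
  · filter_upwards [self_mem_ae_restrict measurableSet_Ioi] with t ht w hw
    have hne : (t : ℂ) - w ≠ 0 := by
      rw [← norm_pos_iff]
      exact hδ.trans_le (h t (le_of_lt ht) w hw)
    have h1 := (((hasDerivAt_id w).const_sub (t : ℂ)).fun_inv hne).const_mul
      ((t : ℂ) ^ α * (p.eval (t : ℂ) * Complex.exp (-t)))
    refine (h1.congr_deriv ?_).congr_of_eventuallyEq (Eventually.of_forall fun w' => ?_)
    · simp only [cauchyKernelPow, id]
      ring
    · simp only [cauchyKernelPow, id]
      ring

/-- Every admissible exponent can be raised by `1` until its real part is at least `1`. -/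
theorem exponent_induction {P : ℂ → Prop} (hbase : ∀ α : ℂ, 1 ≤ α.re → P α)
    (hstep : ∀ α : ℂ, (∀ n : ℕ, α ≠ -((n : ℂ) + 1)) → P (α + 1) → P α) (α : ℂ)
    (hα : ∀ n : ℕ, α ≠ -((n : ℂ) + 1)) : P α := by
  have key : ∀ N : ℕ, ∀ α : ℂ, (∀ n : ℕ, α ≠ -((n : ℂ) + 1)) → 1 ≤ α.re + N → P α := by
    intro N
    induction N with
    | zero => exact fun α _ h => hbase α (by simpa using h)
    | succ N ih =>
      intro α hα h
      refine hstep α hα (ih (α + 1) (ne_neg_succ_add_one hα) ?_)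
      push_cast at h
      rw [Complex.add_re, Complex.one_re]
      linarith
  refine key ⌈1 - α.re⌉₊ α hα ?_
  have := Nat.le_ceil (1 - α.re)
  linarith

theorem hasDerivAt_cauchyIntegral (hα : ∀ n : ℕ, α ≠ -((n : ℂ) + 1)) (p : Polynomial ℂ) {z : ℂ}
    (hz : z ∈ cutPlane) :
    HasDerivAt (cauchyIntegral α p 1) (cauchyIntegral α p 2 z) z := by
  revert hα
  refine exponent_induction (P := fun α => HasDerivAt (cauchyIntegral α p 1)
    (cauchyIntegral α p 2 z) z) (fun α h => hasDerivAt_cauchyIntegral_of_re (by linarith) p hz) ?_ α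
  intro α hα h
  have hz0 := ne_zero_of_mem_cutPlane hz
  have h1 := (h.sub_const (finitePart α (fun t => p.eval t * Complex.exp (-t)))).fun_div
    (hasDerivAt_id z) hz0
  have heq : ∀ w ∈ cutPlane, cauchyIntegral α p 1 w = (cauchyIntegral (α + 1) p 1 w -
      finitePart α (fun t => p.eval t * Complex.exp (-t))) / w := by
    intro w hw
    have := ne_zero_of_mem_cutPlane hw
    rw [cauchyIntegral_add_one hα p hw 0, cauchyIntegral_zero]
    field_simp
    ring
  refine (h1.congr_deriv ?_).congr_of_eventuallyEq ?_
  -- The recurrences for `k = 0` and `k = 1` turn the quotient-rule derivative into the integral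
  -- with squared denominator.
  · rw [cauchyIntegral_add_one hα p hz 0, cauchyIntegral_add_one hα p hz 1, cauchyIntegral_zero]
    simp only [id]
    field_simp
    ring
  · filter_upwards [isOpen_cutPlane.mem_nhds hz] with w hw using heq w hw

/-! ### Cauchy integrals of general densities: boundedness and boundary values -/

theorem integral_inv_ofReal_sub {z : ℂ} (hz : z.im ≠ 0) (a b : ℝ) :
    ∫ t in a..b, ((t : ℂ) - z)⁻¹ = Complex.log (b - z) - Complex.log (a - z) := by
  have hne : ∀ t : ℝ, (t : ℂ) - z ∈ Complex.slitPlane := fun t =>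
    Complex.mem_slitPlane_iff.2 (Or.inr (by simpa using hz))
  refine intervalIntegral.integral_eq_sub_of_hasDerivAt
    (f := fun t : ℝ => Complex.log ((t : ℂ) - z)) (fun t _ => ?_) ?_
  · have h := (((hasDerivAt_id (t : ℂ)).sub_const z).clog (hne t)).comp_ofReal
    simpa using h
  · refine Continuous.intervalIntegrable ?_ _ _
    exact Continuous.inv₀ (by fun_prop) fun t => Complex.slitPlane_ne_zero (hne t)

/-- Equal moduli leave only a difference of arguments. It applies to the endpoints of an interval
centred at `Re z`, which are equidistant from `z`. -/
theorem norm_log_sub_log_le {u v : ℂ} (h : ‖u‖ = ‖v‖) :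
    ‖Complex.log u - Complex.log v‖ ≤ 2 * Real.pi := by
  have h1 : Complex.log u - Complex.log v = ((u.arg - v.arg : ℝ) : ℂ) * Complex.I := by
    rw [Complex.log, Complex.log, h]
    push_cast
    ring
  rw [h1, norm_mul, Complex.norm_I, mul_one, Complex.norm_real, Real.norm_eq_abs]
  have h2 := Complex.abs_arg_le_pi u
  have h3 := Complex.abs_arg_le_pi v
  have h4 := abs_sub u.arg v.arg
  linarith

theorem integrableOn_div_ofReal_sub {φ : ℝ → ℂ} (hφ : IntegrableOn φ (Ioi 0)) {z : ℂ}
    (hz : z ∈ cutPlane) : IntegrableOn (fun t : ℝ => φ t / ((t : ℂ) - z)) (Ioi 0) := by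
  obtain ⟨δ, hδ, h⟩ := exists_le_norm_sub hz
  refine Integrable.mul_bdd (g := fun t : ℝ => ((t : ℂ) - z)⁻¹) (c := δ⁻¹) hφ ?_ ?_
  · refine Measurable.aestronglyMeasurable ?_
    fun_prop
  · filter_upwards [self_mem_ae_restrict measurableSet_Ioi] with t ht
    rw [norm_inv]
    gcongr
    exact h t (le_of_lt ht) z (Metric.mem_ball_self hδ)

/-- Subtracting a constant on an interval from the density of a Cauchy integral. -/
theorem integral_div_ofReal_sub_eq {φ : ℝ → ℂ} (hφ : IntegrableOn φ (Ioi 0)) {z : ℂ}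
    (hz : z.im ≠ 0) (c : ℂ) {a b : ℝ} (ha : 0 ≤ a) (hab : a ≤ b) :
    ∫ t in Ioi (0 : ℝ), φ t / ((t : ℂ) - z) =
      (∫ t in Ioi (0 : ℝ), (φ t - (Ioc a b).indicator (fun _ => c) t) / ((t : ℂ) - z)) +
      c * (Complex.log (b - z) - Complex.log (a - z)) := by
  have hz' := mem_cutPlane_of_im_ne_zero hz
  have hsub : Ioc a b ⊆ Ioi 0 := fun t ht => ha.trans_lt ht.1
  have hc : IntegrableOn ((Ioc a b).indicator (fun _ => c)) (Ioi 0) := by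
    rw [IntegrableOn, integrable_indicator_iff measurableSet_Ioc]
    exact integrableOn_const ((Measure.restrict_apply_le _ _).trans_lt (by simp)).ne
  have h1 : ∫ t in Ioi (0 : ℝ), (Ioc a b).indicator (fun _ => c) t / ((t : ℂ) - z) =
      c * (Complex.log (b - z) - Complex.log (a - z)) := by
    rw [← integral_inv_ofReal_sub hz, intervalIntegral.integral_of_le hab, ← integral_const_mul]
    have h2 : (fun t : ℝ => (Ioc a b).indicator (fun _ => c) t / ((t : ℂ) - z)) =
        (Ioc a b).indicator (fun t : ℝ => c * ((t : ℂ) - z)⁻¹) := by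
      funext t
      by_cases ht : t ∈ Ioc a b
      · simp [ht, div_eq_mul_inv]
      · simp [ht]
    rw [h2, setIntegral_indicator measurableSet_Ioc, inter_eq_right.2 hsub]
  rw [← h1, ← integral_add]
  · congr 1
    funext t
    ring
  · exact integrableOn_div_ofReal_sub (hφ.sub hc) hz'
  · exact integrableOn_div_ofReal_sub hc hz'

theorem abs_ofReal_sub_re_le (t : ℝ) (z : ℂ) : |t - z.re| ≤ ‖(t : ℂ) - z‖ := by
  simpa using Complex.abs_re_le_norm ((t : ℂ) - z)

/-- The Cauchy integral of a bounded Lipschitz density is bounded. -/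
theorem exists_norm_integral_div_le {φ : ℝ → ℂ} (hφ : IntegrableOn φ (Ioi 0))
    (hφ' : IntegrableOn (fun t : ℝ => φ t / t) (Ioi 0)) {B L : ℝ} (hL : 0 ≤ L)
    (hB : ∀ t, 0 < t → ‖φ t‖ ≤ B) (hlip : ∀ s t, 0 < s → 0 < t → ‖φ s - φ t‖ ≤ L * |s - t|) :
    ∃ C : ℝ, ∀ z ∈ cutPlane, ‖∫ t in Ioi (0 : ℝ), φ t / ((t : ℂ) - z)‖ ≤ C := by
  set M₀ := ∫ t in Ioi (0 : ℝ), ‖φ t‖ with hM₀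
  set M₁ := ∫ t in Ioi (0 : ℝ), ‖φ t / t‖ with hM₁
  have hM₀0 : 0 ≤ M₀ := integral_nonneg fun t => norm_nonneg _
  have hM₁0 : 0 ≤ M₁ := integral_nonneg fun t => norm_nonneg _
  have hB0 : 0 ≤ B := (norm_nonneg _).trans (hB 1 one_pos)
  -- `2L`: the interval around `Re z`, of length at most `2`. `M₀` and `2M₁`: points outside it, for
  -- `Re z ≥ 1` and `Re z ≤ 1`. The last term: the constant subtracted on the interval.
  refine ⟨2 * L + M₀ + 2 * M₁ + B * (2 * Real.pi), fun z hz => ?_⟩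
  rcases le_or_gt z.re 0 with hre | hre
  · have h1 : ‖∫ t in Ioi (0 : ℝ), φ t / ((t : ℂ) - z)‖ ≤ M₁ := by
      refine norm_integral_le_of_norm_le hφ'.norm ?_
      filter_upwards [self_mem_ae_restrict measurableSet_Ioi] with t (ht : 0 < t)
      rw [norm_div, norm_div]
      have h2 : ‖(t : ℂ)‖ = t := by simp [abs_of_pos ht]
      have h3 := (le_abs_self _).trans (abs_ofReal_sub_re_le t z)
      rw [h2]
      gcongr
      linarith
    have := mul_nonneg hB0 Real.pi_pos.le
    linarith
  · have him : z.im ≠ 0 := by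
      intro him
      rw [mem_cutPlane_iff, Complex.mem_slitPlane_iff] at hz
      simp only [Complex.neg_re, Complex.neg_im, him] at hz
      rcases hz with hz | hz
      · linarith
      · simp at hz
    set x := z.re with hx
    -- The largest radius up to `1` that keeps the symmetric interval inside the positive axis.
    set δ := min x 1 with hδ
    have hδ0 : 0 < δ := lt_min hre one_pos
    have hδx : δ ≤ x := min_le_left _ _
    have hδ1 : δ ≤ 1 := min_le_right _ _
    rw [integral_div_ofReal_sub_eq hφ him (φ x) (a := x - δ) (b := x + δ) (by linarith)
      (by linarith)]
    have hlog : ‖Complex.log ((x + δ : ℝ) - z) - Complex.log ((x - δ : ℝ) - z)‖ ≤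
        2 * Real.pi := by
      apply norm_log_sub_log_le
      rw [Complex.norm_def, Complex.norm_def, Complex.normSq_apply, Complex.normSq_apply]
      simp only [Complex.sub_re, Complex.sub_im, Complex.ofReal_re, Complex.ofReal_im, ← hx]
      congr 1
      ring
    have hbint : IntegrableOn ((Ioc (x - δ) (x + δ)).indicator (fun _ => L)) (Ioi 0) := by
      rw [IntegrableOn, integrable_indicator_iff measurableSet_Ioc]
      exact integrableOn_const ((Measure.restrict_apply_le _ _).trans_lt (by simp)).ne
    have hmain : ‖∫ t in Ioi (0 : ℝ), (φ t - (Ioc (x - δ) (x + δ)).indicator (fun _ => φ x) t) /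
        ((t : ℂ) - z)‖ ≤ 2 * L + M₀ + 2 * M₁ := by
      have h1 : ∫ t in Ioi (0 : ℝ), ((Ioc (x - δ) (x + δ)).indicator (fun _ => L) t + ‖φ t‖ +
          2 * ‖φ t / t‖) ≤ 2 * L + M₀ + 2 * M₁ := by
        have hadd : IntegrableOn (fun t => (Ioc (x - δ) (x + δ)).indicator (fun _ => L) t + ‖φ t‖)
          (Ioi 0) := hbint.add hφ.norm
        have hsub : Ioc (x - δ) (x + δ) ⊆ Ioi 0 := fun t ht => (sub_nonneg.2 hδx).trans_lt ht.1
        rw [integral_add hadd (hφ'.norm.const_mul 2), integral_add hbint hφ.norm,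
          integral_const_mul, setIntegral_indicator measurableSet_Ioc,
          inter_eq_right.2 hsub, setIntegral_const,
          Real.volume_real_Ioc_of_le (by linarith), smul_eq_mul]
        nlinarith
      refine (norm_integral_le_of_norm_le ((hbint.add hφ.norm).add (hφ'.norm.const_mul 2)) ?_).trans
        h1
      filter_upwards [self_mem_ae_restrict measurableSet_Ioi] with t (ht : 0 < t)
      have h2 := abs_ofReal_sub_re_le t z
      rw [norm_div]
      simp only [Pi.add_apply]
      by_cases htm : t ∈ Ioc (x - δ) (x + δ)
      · rw [indicator_of_mem htm, indicator_of_mem htm]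
        have h3 : ‖φ t - φ x‖ / ‖(t : ℂ) - z‖ ≤ L := by
          refine div_le_of_le_mul₀ (norm_nonneg _) hL ((hlip t x ht hre).trans ?_)
          gcongr
        have h4 := norm_nonneg (φ t)
        have h5 := norm_nonneg (φ t / t)
        linarith
      · rw [indicator_of_notMem htm, indicator_of_notMem htm, sub_zero, zero_add]
        have h4 := norm_nonneg (φ t)
        have h5 := norm_nonneg (φ t / t)
        rcases le_total x 1 with hx1 | hx1
        · have hδe : δ = x := min_eq_left hx1
          -- The interval is now `(0, 2x]`, so outside it `t - x ≥ t/2`, and `φ(t)/t` controls the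
          -- integrand.
          have h6 : 2 * x < t := by
            by_contra! h
            exact htm ⟨by linarith, by linarith⟩
          have h7 : t / 2 ≤ ‖(t : ℂ) - z‖ := by
            have := (le_abs_self _).trans h2
            linarith
          have h8 : ‖φ t‖ / ‖(t : ℂ) - z‖ ≤ 2 * ‖φ t / t‖ := by
            rw [norm_div, Complex.norm_real, Real.norm_of_nonneg ht.le]
            calc ‖φ t‖ / ‖(t : ℂ) - z‖ ≤ ‖φ t‖ / (t / 2) := by gcongr
              _ = 2 * (‖φ t‖ / t) := by field_simp
          linarith
        · have hδe : δ = 1 := min_eq_right hx1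
          have h6 : 1 ≤ |t - x| := by
            by_contra! h
            rw [abs_lt] at h
            exact htm ⟨by linarith, by linarith⟩
          have h8 : ‖φ t‖ / ‖(t : ℂ) - z‖ ≤ ‖φ t‖ := div_le_self h4 (h6.trans h2)
          linarith
    refine (norm_add_le _ _).trans (add_le_add hmain ?_)
    rw [norm_mul]
    exact mul_le_mul (hB x hre) hlog (norm_nonneg _) hB0

/-- The boundary values of a Cauchy integral (Plemelj's formula). -/
theorem exists_tendsto_integral_div {φ : ℂ → ℂ} {x : ℝ} (hx : 0 < x) (hφ : AnalyticAt ℂ φ x)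
    (hi : IntegrableOn (fun t : ℝ => φ t) (Ioi 0)) :
    ∃ A : ℂ, Tendsto (fun z => ∫ t in Ioi (0 : ℝ), φ t / ((t : ℂ) - z))
        (𝓝[{z : ℂ | 0 < z.im}] (x : ℂ)) (𝓝 (A + Real.pi * Complex.I * φ x)) ∧
      Tendsto (fun z => ∫ t in Ioi (0 : ℝ), φ t / ((t : ℂ) - z))
        (𝓝[{z : ℂ | z.im < 0}] (x : ℂ)) (𝓝 (A - Real.pi * Complex.I * φ x)) := by
  obtain ⟨K, s, hs, hlip⟩ := (hφ.contDiffAt (n := 1)).exists_lipschitzOnWith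
  obtain ⟨ε', hε', hball⟩ := Metric.mem_nhds_iff.1 hs
  obtain ⟨ε, hε, hεx, hεε'⟩ : ∃ ε : ℝ, 0 < ε ∧ ε ≤ x ∧ ε < ε' :=
    ⟨min x (ε' / 2), lt_min hx (by positivity), min_le_left _ _,
      (min_le_right _ _).trans_lt (by linarith)⟩
  set a := x - ε with ha
  set b := x + ε with hb
  -- Subtracting `φ(z)` at the complex point itself lets the Lipschitz constant bound the quotient
  -- uniformly in `z`; the whole jump then sits in the logarithms.
  set k : ℂ → ℝ → ℂ := fun z t => (φ t - (Ioc a b).indicator (fun _ => φ z) t) / ((t : ℂ) - z)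
    with hk
  have hφc : ContinuousAt φ x := hφ.continuousAt
  have hA : Tendsto (fun z => ∫ t in Ioi (0 : ℝ), k z t) (𝓝[{z : ℂ | z.im ≠ 0}] (x : ℂ))
      (𝓝 (∫ t in Ioi (0 : ℝ), k x t)) := by
    refine tendsto_integral_filter_of_dominated_convergence
      (fun t : ℝ => (Ioc a b).indicator (fun _ => (K : ℝ)) t + ‖φ t‖ * (ε / 2)⁻¹) ?_ ?_ ?_ ?_
    · refine Eventually.of_forall fun z => ?_
      refine AEStronglyMeasurable.mul (hi.aestronglyMeasurable.sub ?_) ?_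
      · exact (measurable_const.indicator measurableSet_Ioc).aestronglyMeasurable
      · exact Measurable.aestronglyMeasurable (by fun_prop)
    · have hnear : ∀ᶠ z in 𝓝[{z : ℂ | z.im ≠ 0}] (x : ℂ), z ∈ Metric.ball (x : ℂ) (ε / 2) :=
        nhdsWithin_le_nhds (Metric.ball_mem_nhds _ (by positivity))
      filter_upwards [hnear, self_mem_nhdsWithin] with z hz him
      filter_upwards [self_mem_ae_restrict measurableSet_Ioi] with t (ht : 0 < t)
      rw [Metric.mem_ball, dist_eq_norm] at hz
      simp only [hk]
      rw [norm_div]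
      have h4 := norm_nonneg (φ t)
      by_cases htm : t ∈ Ioc a b
      · rw [indicator_of_mem htm, indicator_of_mem htm]
        have h3 : ‖φ t - φ z‖ / ‖(t : ℂ) - z‖ ≤ K := by
          refine div_le_of_le_mul₀ (norm_nonneg _) K.2 ?_
          rw [← dist_eq_norm, ← dist_eq_norm]
          refine hlip.dist_le_mul _ (hball ?_) _ (hball ?_)
          · rw [Metric.mem_ball, dist_eq_norm, ← Complex.ofReal_sub, Complex.norm_real,
              Real.norm_eq_abs, abs_lt]
            exact ⟨by linarith [htm.1], by linarith [htm.2]⟩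
          · rw [Metric.mem_ball, dist_eq_norm]
            linarith
        have : 0 ≤ ‖φ t‖ * (ε / 2)⁻¹ := by positivity
        linarith
      · rw [indicator_of_notMem htm, indicator_of_notMem htm, sub_zero, zero_add, div_eq_mul_inv]
        gcongr
        have h6 : ε ≤ |t - x| := by
          by_contra! h
          rw [abs_lt] at h
          exact htm ⟨by linarith, by linarith⟩
        have h7 : |t - x| ≤ ‖(t : ℂ) - z‖ + ‖z - x‖ := by
          have := norm_add_le ((t : ℂ) - z) (z - x)
          rwa [sub_add_sub_cancel, ← Complex.ofReal_sub, Complex.norm_real,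
            Real.norm_eq_abs] at this
        linarith
    · refine Integrable.add ?_ (hi.norm.mul_const _)
      rw [integrable_indicator_iff measurableSet_Ioc]
      exact integrableOn_const ((Measure.restrict_apply_le _ _).trans_lt (by simp)).ne
    · have hne : ∀ᵐ t ∂(volume.restrict (Ioi (0 : ℝ))), t ≠ x :=
        ae_restrict_of_ae (Measure.ae_ne volume x)
      filter_upwards [hne] with t ht
      have hne' : (t : ℂ) - x ≠ 0 := by
        rw [sub_ne_zero]
        exact_mod_cast ht
      refine Tendsto.mono_left ?_ nhdsWithin_le_nhds
      refine ContinuousAt.div (f := fun z => φ t - (Ioc a b).indicator (fun _ => φ z) t)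
        (g := fun z => (t : ℂ) - z) ?_ (by fun_prop) hne'
      refine continuousAt_const.sub ?_
      by_cases htm : t ∈ Ioc a b
      · simpa only [indicator_of_mem htm] using hφc
      · simpa only [indicator_of_notMem htm] using continuousAt_const
  have hnorm : ‖((a : ℂ) - x)‖ = ε := by
    rw [ha, ← Complex.ofReal_sub, Complex.norm_real, Real.norm_eq_abs, sub_sub_cancel_left,
      abs_neg, abs_of_pos hε]
  have hre : ((a : ℂ) - x).re < 0 := by
    simp only [Complex.sub_re, Complex.ofReal_re]
    linarith
  have him : ((a : ℂ) - x).im = 0 := by simp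
  have hlogb : Tendsto (fun z : ℂ => Complex.log (b - z)) (𝓝 (x : ℂ)) (𝓝 (Real.log ε)) := by
    have h1 : (b : ℂ) - x = (ε : ℝ) := by
      rw [hb]
      push_cast
      ring
    have h2 : ContinuousAt (fun z : ℂ => Complex.log (b - z)) (x : ℂ) := by
      refine ContinuousAt.clog (by fun_prop) ?_
      rw [h1]
      exact Complex.ofReal_mem_slitPlane.2 hε
    have h3 := h2.tendsto
    rwa [h1, ← Complex.ofReal_log hε.le] at h3
  have hsub : ContinuousAt (fun z : ℂ => (a : ℂ) - z) (x : ℂ) := by fun_prop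
  -- For `Im z > 0` the point `a - z` approaches the negative axis from below, hence the sign `-πi`.
  have hup : Tendsto (fun z : ℂ => Complex.log (a - z)) (𝓝[{z : ℂ | 0 < z.im}] (x : ℂ))
      (𝓝 (Real.log ε - Real.pi * Complex.I)) := by
    rw [← hnorm]
    refine (Complex.tendsto_log_nhdsWithin_im_neg_of_re_neg_of_im_zero hre him).comp ?_
    refine tendsto_nhdsWithin_iff.2 ⟨hsub.tendsto.mono_left nhdsWithin_le_nhds, ?_⟩
    filter_upwards [self_mem_nhdsWithin] with z (hz : 0 < z.im)
    simpa using hz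
  have hlow : Tendsto (fun z : ℂ => Complex.log (a - z)) (𝓝[{z : ℂ | z.im < 0}] (x : ℂ))
      (𝓝 (Real.log ε + Real.pi * Complex.I)) := by
    rw [← hnorm]
    refine (Complex.tendsto_log_nhdsWithin_im_nonneg_of_re_neg_of_im_zero hre him).comp ?_
    refine tendsto_nhdsWithin_iff.2 ⟨hsub.tendsto.mono_left nhdsWithin_le_nhds, ?_⟩
    filter_upwards [self_mem_nhdsWithin] with z (hz : z.im < 0)
    simpa using hz.le
  have hrepr : ∀ z : ℂ, z.im ≠ 0 → ∫ t in Ioi (0 : ℝ), φ t / ((t : ℂ) - z) =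
      (∫ t in Ioi (0 : ℝ), k z t) + φ z * (Complex.log (b - z) - Complex.log (a - z)) :=
    fun z hz => integral_div_ofReal_sub_eq hi hz (φ z) (by linarith) (by linarith)
  refine ⟨∫ t in Ioi (0 : ℝ), k x t, ?_, ?_⟩
  · have h1 := (hA.mono_left (nhdsWithin_mono _ fun z (hz : 0 < z.im) => hz.ne')).add
      ((hφc.tendsto.mono_left nhdsWithin_le_nhds).mul
        ((hlogb.mono_left nhdsWithin_le_nhds).sub hup))
    refine (h1.congr' ?_).trans_eq ?_
    · filter_upwards [self_mem_nhdsWithin] with z hz using (hrepr z (ne_of_gt hz)).symm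
    · congr 1
      ring
  · have h1 := (hA.mono_left (nhdsWithin_mono _ fun z (hz : z.im < 0) => hz.ne)).add
      ((hφc.tendsto.mono_left nhdsWithin_le_nhds).mul
        ((hlogb.mono_left nhdsWithin_le_nhds).sub hlow))
    refine (h1.congr' ?_).trans_eq ?_
    · filter_upwards [self_mem_nhdsWithin] with z hz using (hrepr z (ne_of_lt hz)).symm
    · congr 1
      ring

/-! ### The weight and its Cauchy integral for large `Re α` -/

theorem exists_norm_cpow_mul_exp_le {α : ℂ} (hα : 0 ≤ α.re) (p : Polynomial ℂ) :
    ∃ B : ℝ, ∀ t : ℝ, 0 < t → ‖(t : ℂ) ^ α * (p.eval (t : ℂ) * Complex.exp (-t))‖ ≤ B := by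
  obtain ⟨T, hT⟩ := ((tendsto_cpow_mul_exp α p).norm.eventually_le_const
    (show ‖(0 : ℂ)‖ < 1 by simp)).exists_forall_of_atTop
  obtain ⟨D, hD⟩ := (isCompact_Icc (a := (0 : ℝ)) (b := T)).exists_bound_of_continuousOn
    ((continuous_weight p).comp Complex.continuous_ofReal).continuousOn
  refine ⟨max 1 (T ^ α.re * D), fun t ht => ?_⟩
  rcases le_total T t with h | h
  · exact (hT t h).trans (le_max_left _ _)
  · refine le_trans ?_ (le_max_right _ _)
    rw [norm_mul, Complex.norm_cpow_eq_rpow_re_of_pos ht]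
    have h1 : t ^ α.re ≤ T ^ α.re := Real.rpow_le_rpow ht.le h hα
    exact mul_le_mul h1 (hD t ⟨ht.le, h⟩) (norm_nonneg _) ((Real.rpow_nonneg ht.le _).trans h1)

/-- The derivative contains `t^(α-1)`, which stays bounded near `0` exactly because `Re α ≥ 1`; this
fixes the base case of the induction on the exponent. -/
theorem exists_lipschitz_cpow_mul_exp {α : ℂ} (hα : 1 ≤ α.re) (p : Polynomial ℂ) :
    ∃ L : ℝ, 0 ≤ L ∧ ∀ s t : ℝ, 0 < s → 0 < t →
      ‖(s : ℂ) ^ α * (p.eval (s : ℂ) * Complex.exp (-s)) -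
        (t : ℂ) ^ α * (p.eval (t : ℂ) * Complex.exp (-t))‖ ≤ L * |s - t| := by
  obtain ⟨B₁, h₁⟩ := exists_norm_cpow_mul_exp_le (α := α - 1) (by simpa using hα) p
  obtain ⟨B₂, h₂⟩ := exists_norm_cpow_mul_exp_le (α := α) (by linarith) (p.derivative - p)
  have hα0 : α ≠ 0 := by
    rintro rfl
    norm_num at hα
  have hB₁ := (norm_nonneg _).trans (h₁ 1 one_pos)
  have hB₂ := (norm_nonneg _).trans (h₂ 1 one_pos)
  refine ⟨‖α‖ * B₁ + B₂, by positivity, fun s t hs ht => ?_⟩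
  have hderiv : ∀ x ∈ Ioi (0 : ℝ), HasDerivWithinAt
      (fun t : ℝ => (t : ℂ) ^ α * (p.eval (t : ℂ) * Complex.exp (-t)))
      (α * ((x : ℂ) ^ (α - 1) * (p.eval (x : ℂ) * Complex.exp (-x))) +
        (x : ℂ) ^ α * ((p.derivative - p).eval (x : ℂ) * Complex.exp (-x))) (Ioi 0) x := by
    intro x (hx : 0 < x)
    have h1 : HasDerivAt (fun t : ℂ => Complex.exp (-t)) (-Complex.exp (-(x : ℂ))) x := by
      simpa using (hasDerivAt_neg (x : ℂ)).cexp
    have h2 := ((p.hasDerivAt (x : ℂ)).fun_mul h1).comp_ofReal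
    have h3 := (hasDerivAt_ofReal_cpow_const hx.ne' hα0).fun_mul h2
    refine (h3.congr_deriv ?_).hasDerivWithinAt
    rw [Polynomial.eval_sub]
    ring
  have := (convex_Ioi (0 : ℝ)).norm_image_sub_le_of_norm_hasDerivWithin_le
    (C := ‖α‖ * B₁ + B₂) hderiv ?_ ht hs
  · simpa only [Real.norm_eq_abs] using this
  · intro x hx
    refine (norm_add_le _ _).trans ?_
    rw [norm_mul]
    gcongr
    · exact h₁ x hx
    · exact h₂ x hx

theorem cauchyIntegral_one_eq_integral (hα : -1 < α.re) (p : Polynomial ℂ) {z : ℂ}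
    (hz : z ∈ cutPlane) : cauchyIntegral α p 1 z =
      ∫ t in Ioi (0 : ℝ), (t : ℂ) ^ α * (p.eval (t : ℂ) * Complex.exp (-t)) / ((t : ℂ) - z) := by
  rw [cauchyIntegral_eq_integral hα p hz]
  simp only [cauchyKernelPow, pow_one, mul_div_assoc]

theorem exists_norm_cauchyIntegral_le (hα : 1 ≤ α.re) (p : Polynomial ℂ) :
    ∃ C : ℝ, ∀ z ∈ cutPlane, ‖cauchyIntegral α p 1 z‖ ≤ C := by
  obtain ⟨B, hB⟩ := exists_norm_cpow_mul_exp_le (α := α) (by linarith) p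
  obtain ⟨L, hL, hlip⟩ := exists_lipschitz_cpow_mul_exp hα p
  have hi : IntegrableOn (fun t : ℝ => (t : ℂ) ^ α * (p.eval (t : ℂ) * Complex.exp (-t)) / t)
      (Ioi 0) := by
    refine (integrableOn_Ioi_zero_cpow_mul_exp (α := α - 1) ?_ p).congr_fun (fun t ht => ?_)
      measurableSet_Ioi
    · rw [Complex.sub_re, Complex.one_re]
      linarith
    · have ht' : (t : ℂ) ≠ 0 := by exact_mod_cast (ne_of_gt ht)
      simp only
      rw [Complex.cpow_sub _ _ ht', Complex.cpow_one]
      ring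
  obtain ⟨C, hC⟩ := exists_norm_integral_div_le
    (integrableOn_Ioi_zero_cpow_mul_exp (by linarith) p) hi hL hB hlip
  refine ⟨C, fun z hz => ?_⟩
  rw [cauchyIntegral_one_eq_integral (by linarith) p hz]
  exact hC z hz

theorem exists_tendsto_cauchyIntegral_of_re (hα : -1 < α.re) (p : Polynomial ℂ) {x : ℝ}
    (hx : 0 < x) : ∃ A : ℂ,
      Tendsto (cauchyIntegral α p 1) (𝓝[{z : ℂ | 0 < z.im}] (x : ℂ))
        (𝓝 (A + Real.pi * Complex.I * ((x : ℂ) ^ α * (p.eval (x : ℂ) * Complex.exp (-x))))) ∧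
      Tendsto (cauchyIntegral α p 1) (𝓝[{z : ℂ | z.im < 0}] (x : ℂ))
        (𝓝 (A - Real.pi * Complex.I * ((x : ℂ) ^ α * (p.eval (x : ℂ) * Complex.exp (-x))))) := by
  have han : AnalyticAt ℂ (fun t : ℂ => t ^ α * (p.eval t * Complex.exp (-t))) x := by
    rw [Complex.analyticAt_iff_eventually_differentiableAt]
    filter_upwards [Complex.isOpen_slitPlane.mem_nhds (Complex.ofReal_mem_slitPlane.2 hx)] with t ht
    exact (differentiableAt_id.cpow_const ht).mul (by fun_prop)
  obtain ⟨A, h1, h2⟩ := exists_tendsto_integral_div hx han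
    (integrableOn_Ioi_zero_cpow_mul_exp hα p)
  refine ⟨A, h1.congr' ?_, h2.congr' ?_⟩
  · filter_upwards [self_mem_nhdsWithin] with z hz
    exact (cauchyIntegral_one_eq_integral hα p (mem_cutPlane_of_im_ne_zero (ne_of_gt hz))).symm
  · filter_upwards [self_mem_nhdsWithin] with z hz
    exact (cauchyIntegral_one_eq_integral hα p (mem_cutPlane_of_im_ne_zero (ne_of_lt hz))).symm

/-! ### Extension across the cut -/

/-- A continuous function on an open set which is holomorphic off the real axis is holomorphic. -/
theorem differentiableOn_of_differentiableOn_im_ne_zero {U : Set ℂ} (hU : IsOpen U) {g : ℂ → ℂ}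
    (hc : ContinuousOn g U) (hd : DifferentiableOn ℂ g (U ∩ {z | z.im ≠ 0})) :
    DifferentiableOn ℂ g U := by
  -- Morera's theorem: a rectangle crossing the real axis is split along it, and Cauchy's theorem
  -- holds on each half, where the function is holomorphic inside and continuous up to the boundary.
  refine (Complex.isConservativeOn_and_continuousOn_iff_isDifferentiableOn hU).1 ⟨?_, hc⟩
  intro z w hzw
  rw [← add_eq_zero_iff_eq_neg, Complex.wedgeIntegral_add_wedgeIntegral_eq]
  have hrect : ∀ z w : ℂ, Complex.Rectangle z w ⊆ U →
      (0 : ℝ) ∉ Ioo (min z.im w.im) (max z.im w.im) →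
      (∫ x : ℝ in z.re..w.re, g (x + z.im * Complex.I)) -
      (∫ x : ℝ in z.re..w.re, g (x + w.im * Complex.I)) +
      Complex.I • (∫ y : ℝ in z.im..w.im, g (w.re + y * Complex.I)) -
      Complex.I • (∫ y : ℝ in z.im..w.im, g (z.re + y * Complex.I)) = 0 := by
    intro z w hzw h0
    refine Complex.integral_boundary_rect_eq_zero_of_continuousOn_of_differentiableOn g z w
      (hc.mono hzw) (hd.mono fun u hu => ⟨hzw ?_, fun h => h0 ?_⟩)
    · exact ⟨Ioo_subset_Icc_self hu.1, Ioo_subset_Icc_self hu.2⟩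
    · rw [← h]
      exact hu.2
  by_cases h0 : (0 : ℝ) ∈ Ioo (min z.im w.im) (max z.im w.im)
  · have h0' : (0 : ℝ) ∈ uIcc z.im w.im := Ioo_subset_Icc_self h0
    have hs₁ : uIcc z.im (0 : ℝ) ⊆ uIcc z.im w.im := uIcc_subset_uIcc left_mem_uIcc h0'
    have hs₂ : uIcc (0 : ℝ) w.im ⊆ uIcc z.im w.im := uIcc_subset_uIcc h0' right_mem_uIcc
    have h1 := hrect z (w.re : ℂ) (fun u hu => hzw ⟨by simpa using hu.1, hs₁ (by simpa using hu.2)⟩)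
      (by
        rw [Complex.ofReal_im, mem_Ioo, min_lt_iff, lt_max_iff]
        rintro ⟨h | h, h' | h'⟩ <;> linarith)
    have h2 := hrect (z.re : ℂ) w (fun u hu => hzw ⟨by simpa using hu.1, hs₂ (by simpa using hu.2)⟩)
      (by
        rw [Complex.ofReal_im, mem_Ioo, min_lt_iff, lt_max_iff]
        rintro ⟨h | h, h' | h'⟩ <;> linarith)
    have hvert : ∀ x ∈ uIcc z.re w.re, ∀ a b : ℝ, uIcc a b ⊆ uIcc z.im w.im →
        IntervalIntegrable (fun y : ℝ => g (x + y * Complex.I)) volume a b := by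
      intro x hx a b hab
      refine ContinuousOn.intervalIntegrable ?_
      refine hc.comp (by fun_prop) fun y hy => hzw ⟨?_, ?_⟩
      · simpa using hx
      · simpa using hab hy
    have h3 := intervalIntegral.integral_add_adjacent_intervals
      (hvert w.re right_mem_uIcc _ _ hs₁) (hvert w.re right_mem_uIcc _ _ hs₂)
    have h4 := intervalIntegral.integral_add_adjacent_intervals
      (hvert z.re left_mem_uIcc _ _ hs₁) (hvert z.re left_mem_uIcc _ _ hs₂)
    simp only [Complex.ofReal_re, Complex.ofReal_im] at h1 h2
    rw [← h3, ← h4, smul_add, smul_add]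
    linear_combination h1 + h2
  · exact hrect z w hzw h0

theorem im_ne_zero_eq_union : {z : ℂ | z.im ≠ 0} = {z | 0 < z.im} ∪ {z | z.im < 0} := by
  ext z
  simp only [mem_ofPred_eq, mem_union]
  rw [ne_iff_lt_or_gt, or_comm]

instance neBot_nhdsWithin_im_pos (x : ℝ) : (𝓝[{z : ℂ | 0 < z.im}] (x : ℂ)).NeBot := by
  rw [← mem_closure_iff_nhdsWithin_neBot]
  have h := Complex.closure_setOfPred_lt_im 0
  exact h.symm ▸ (show (0 : ℝ) ≤ (x : ℂ).im by simp)

instance neBot_nhdsWithin_im_neg (x : ℝ) : (𝓝[{z : ℂ | z.im < 0}] (x : ℂ)).NeBot := by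
  rw [← mem_closure_iff_nhdsWithin_neBot]
  have h := Complex.closure_setOfPred_im_lt 0
  exact h.symm ▸ (show (x : ℂ).im ≤ (0 : ℝ) by simp)

theorem dense_im_ne_zero : Dense {z : ℂ | z.im ≠ 0} := by
  intro z
  rcases eq_or_ne z.im 0 with h | h
  · obtain ⟨x, rfl⟩ : ∃ x : ℝ, (x : ℂ) = z := ⟨z.re, Complex.ext (by simp) (by simp [h])⟩
    have hsub : {w : ℂ | 0 < w.im} ⊆ {w : ℂ | w.im ≠ 0} := fun w (hw : 0 < w.im) => hw.ne'
    refine closure_mono hsub ?_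
    exact mem_closure_iff_nhdsWithin_neBot.2 (neBot_nhdsWithin_im_pos x)
  · exact subset_closure h

theorem exists_ofReal_of_notMem_cutPlane {z : ℂ} (hz : z ∉ cutPlane) (h0 : z ≠ 0) :
    ∃ x : ℝ, 0 < x ∧ (x : ℂ) = z := by
  rw [cutPlane, notMem_compl_iff] at hz
  obtain ⟨x, hx, rfl⟩ := hz
  refine ⟨x, lt_of_le_of_ne hx ?_, rfl⟩
  rintro rfl
  simp at h0

/-- A holomorphic function on the cut plane whose boundary values on both sides of the cut agree
extends holomorphically across the cut. -/
theorem exists_extension_of_boundary_eq {f : ℂ → ℂ} (hf : DifferentiableOn ℂ f cutPlane)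
    (hlim : ∀ x : ℝ, 0 < x → ∃ c : ℂ, Tendsto f (𝓝[{z : ℂ | 0 < z.im}] (x : ℂ)) (𝓝 c) ∧
      Tendsto f (𝓝[{z : ℂ | z.im < 0}] (x : ℂ)) (𝓝 c)) :
    ∃ g : ℂ → ℂ, DifferentiableOn ℂ g {0}ᶜ ∧ EqOn f g cutPlane := by
  have hcut : ∀ z ∈ cutPlane, Tendsto f (𝓝[{z : ℂ | z.im ≠ 0}] z) (𝓝 (f z)) := fun z hz =>
    (hf.continuousOn.continuousAt (isOpen_cutPlane.mem_nhds hz)).tendsto.mono_left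
      nhdsWithin_le_nhds
  have heq : EqOn f (extendFrom {z : ℂ | z.im ≠ 0} f) cutPlane := fun z hz =>
    (extendFrom_eq (dense_im_ne_zero z) (hcut z hz)).symm
  refine ⟨extendFrom {z : ℂ | z.im ≠ 0} f, ?_, heq⟩
  refine differentiableOn_of_differentiableOn_im_ne_zero isOpen_compl_singleton ?_ ?_
  · refine continuousOn_extendFrom (fun z _ => dense_im_ne_zero z) fun z hz => ?_
    by_cases hzc : z ∈ cutPlane
    · exact ⟨_, hcut z hzc⟩
    · obtain ⟨x, hx, rfl⟩ := exists_ofReal_of_notMem_cutPlane hzc hz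
      obtain ⟨c, h1, h2⟩ := hlim x hx
      refine ⟨c, ?_⟩
      rw [im_ne_zero_eq_union, nhdsWithin_union]
      exact h1.sup h2
  · refine (hf.mono fun z hz => mem_cutPlane_of_im_ne_zero hz.2).congr fun z hz => ?_
    exact (heq (mem_cutPlane_of_im_ne_zero hz.2)).symm

theorem norm_le_of_forall_cutPlane {g : ℂ → ℂ} (hg : ContinuousOn g {0}ᶜ) {B : ℂ → ℝ}
    (hB : ContinuousOn B {0}ᶜ) {U : Set ℂ} (hU : IsOpen U)
    (h : ∀ z ∈ U, z ∈ cutPlane → ‖g z‖ ≤ B z) {z : ℂ} (hz : z ∈ U) (h0 : z ≠ 0) :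
    ‖g z‖ ≤ B z := by
  by_cases hzc : z ∈ cutPlane
  · exact h z hz hzc
  · obtain ⟨x, hx, rfl⟩ := exists_ofReal_of_notMem_cutPlane hzc h0
    have hn : ({0}ᶜ : Set ℂ) ∈ 𝓝 (x : ℂ) := isOpen_compl_singleton.mem_nhds h0
    refine le_of_tendsto_of_tendsto
      ((hg.continuousAt hn).norm.tendsto.mono_left (nhdsWithin_le_nhds (s := {z : ℂ | 0 < z.im})))
      ((hB.continuousAt hn).tendsto.mono_left nhdsWithin_le_nhds) ?_
    filter_upwards [self_mem_nhdsWithin, nhdsWithin_le_nhds (hU.mem_nhds hz)] with w hw hwU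
    exact h w hwU (mem_cutPlane_of_im_ne_zero (ne_of_gt hw))

/-- Under the additional assumption of boundedness at `0` the extension is entire. -/
theorem exists_entire_extension {f : ℂ → ℂ} (hf : DifferentiableOn ℂ f cutPlane)
    (hlim : ∀ x : ℝ, 0 < x → ∃ c : ℂ, Tendsto f (𝓝[{z : ℂ | 0 < z.im}] (x : ℂ)) (𝓝 c) ∧
      Tendsto f (𝓝[{z : ℂ | z.im < 0}] (x : ℂ)) (𝓝 c))
    (hb : f =O[𝓝[cutPlane] 0] (fun _ : ℂ => (1 : ℝ))) :
    ∃ g : ℂ → ℂ, Differentiable ℂ g ∧ EqOn f g cutPlane := by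
  obtain ⟨g, hg, hfg⟩ := exists_extension_of_boundary_eq hf hlim
  obtain ⟨C, hC⟩ := hb.bound
  rw [eventually_nhdsWithin_iff, Metric.eventually_nhds_iff_ball] at hC
  obtain ⟨ε, hε, hC⟩ := hC
  have hbd : ∀ z ∈ Metric.ball (0 : ℂ) ε, z ≠ 0 → ‖g z‖ ≤ C := fun z hz h0 =>
    norm_le_of_forall_cutPlane hg.continuousOn continuousOn_const Metric.isOpen_ball
      (fun w hw hwc => by simpa [← hfg hwc] using hC w hw hwc) hz h0
  -- Riemann's removable singularity theorem at `0`.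
  refine ⟨Function.update g 0 (limUnder (𝓝[≠] 0) g), ?_, fun z hz => ?_⟩
  · rw [← differentiableOn_univ]
    refine Complex.differentiableOn_update_limUnder_of_isLittleO univ_mem (by
      rwa [← compl_eq_univ_sdiff]) ?_
    refine IsBoundedUnder.isLittleO_sub_self_inv ⟨C + ‖g 0‖, ?_⟩
    rw [eventually_map, eventually_nhdsWithin_iff]
    filter_upwards [Metric.ball_mem_nhds (0 : ℂ) hε] with z hz h0
    exact norm_sub_le_of_le (hbd z hz h0) le_rfl
  · rw [Function.update_of_ne (ne_zero_of_mem_cutPlane hz), hfg hz]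

/-! ### The branch `z^α`: size, derivative, boundary values -/

theorem exp_log_neg_add {z : ℂ} (hz : z ∈ cutPlane) :
    Complex.exp (Complex.log (-z) + (Real.pi : ℂ) * Complex.I) = z := by
  rw [Complex.exp_add, Complex.exp_log (neg_ne_zero.2 (ne_zero_of_mem_cutPlane hz)),
    Complex.exp_pi_mul_I]
  ring

theorem cutPow_add_one (α : ℂ) {z : ℂ} (hz : z ∈ cutPlane) :
    cutPow (α + 1) z = cutPow α z * z := by
  rw [cutPow, cutPow, add_mul, one_mul, Complex.exp_add, exp_log_neg_add hz]

theorem hasDerivAt_cutPow (α : ℂ) {z : ℂ} (hz : z ∈ cutPlane) :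
    HasDerivAt (cutPow α) (α * cutPow α z / z) z := by
  have h0 := ne_zero_of_mem_cutPlane hz
  have h := ((((hasDerivAt_neg z).clog (mem_cutPlane_iff.1 hz)).add_const
    ((Real.pi : ℂ) * Complex.I)).const_mul α).cexp
  refine h.congr_deriv ?_
  rw [cutPow]
  field_simp

theorem norm_cutPow_le (α : ℂ) {z : ℂ} (h0 : z ≠ 0) :
    ‖cutPow α z‖ ≤ Real.exp (|α.im| * (2 * Real.pi)) * ‖z‖ ^ α.re := by
  rw [cutPow, Complex.norm_exp, Real.rpow_def_of_pos (norm_pos_iff.2 h0), ← Real.exp_add]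
  refine Real.exp_le_exp.2 ?_
  have h1 : (α * (Complex.log (-z) + (Real.pi : ℂ) * Complex.I)).re =
      α.re * Real.log ‖z‖ - α.im * ((-z).arg + Real.pi) := by
    simp [Complex.mul_re, Complex.log_re, Complex.log_im]
  have h2 : |(-z).arg + Real.pi| ≤ 2 * Real.pi := by
    have h3 := Complex.abs_arg_le_pi (-z)
    have h4 := abs_add_le (-z).arg Real.pi
    rw [abs_of_pos Real.pi_pos] at h4
    linarith
  have h5 : -(α.im * ((-z).arg + Real.pi)) ≤ |α.im| * (2 * Real.pi) := by
    refine (neg_le_abs _).trans ?_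
    rw [abs_mul]
    gcongr
  rw [h1]
  linarith

theorem tendsto_cutPow_above (α : ℂ) {x : ℝ} (hx : 0 < x) :
    Tendsto (cutPow α) (𝓝[{z : ℂ | 0 < z.im}] (x : ℂ)) (𝓝 ((x : ℂ) ^ α)) := by
  have h1 : Tendsto (fun z : ℂ => Complex.log (-z)) (𝓝[{z : ℂ | 0 < z.im}] (x : ℂ))
      (𝓝 (Real.log ‖-(x : ℂ)‖ - Real.pi * Complex.I)) := by
    refine (Complex.tendsto_log_nhdsWithin_im_neg_of_re_neg_of_im_zero (by simpa) (by simp)).comp ?_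
    refine tendsto_nhdsWithin_iff.2
      ⟨(continuous_neg.tendsto _).mono_left nhdsWithin_le_nhds, ?_⟩
    filter_upwards [self_mem_nhdsWithin] with z (hz : 0 < z.im)
    simpa using hz
  have h2 := ((h1.add_const ((Real.pi : ℂ) * Complex.I)).const_mul α).cexp
  refine h2.trans_eq ?_
  rw [Complex.cpow_def_of_ne_zero (by exact_mod_cast hx.ne'), norm_neg, Complex.norm_real,
    Real.norm_of_nonneg hx.le, Complex.ofReal_log hx.le, sub_add_cancel, mul_comm]

/-- The argument tends to `2π` below the cut and to `0` above it, which accounts for the factor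
`e^{2πiα}`. -/
theorem tendsto_cutPow_below (α : ℂ) {x : ℝ} (hx : 0 < x) :
    Tendsto (cutPow α) (𝓝[{z : ℂ | z.im < 0}] (x : ℂ))
      (𝓝 ((x : ℂ) ^ α * Complex.exp (2 * Real.pi * Complex.I * α))) := by
  have h1 : Tendsto (fun z : ℂ => Complex.log (-z)) (𝓝[{z : ℂ | z.im < 0}] (x : ℂ))
      (𝓝 (Real.log ‖-(x : ℂ)‖ + Real.pi * Complex.I)) := by
    refine (Complex.tendsto_log_nhdsWithin_im_nonneg_of_re_neg_of_im_zero (by simpa)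
      (by simp)).comp ?_
    refine tendsto_nhdsWithin_iff.2
      ⟨(continuous_neg.tendsto _).mono_left nhdsWithin_le_nhds, ?_⟩
    filter_upwards [self_mem_nhdsWithin] with z (hz : z.im < 0)
    simpa using hz.le
  have h2 := ((h1.add_const ((Real.pi : ℂ) * Complex.I)).const_mul α).cexp
  refine h2.trans_eq ?_
  rw [Complex.cpow_def_of_ne_zero (by exact_mod_cast hx.ne'), norm_neg, Complex.norm_real,
    Real.norm_of_nonneg hx.le, Complex.ofReal_log hx.le, ← Complex.exp_add]
  congr 2
  ring

theorem exp_two_pi_mul_I_mul_ne_one {α : ℂ} (hα : ∀ n : ℤ, α ≠ n) :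
    Complex.exp (2 * Real.pi * Complex.I * α) ≠ 1 := by
  rw [Ne, Complex.exp_eq_one_iff]
  rintro ⟨n, hn⟩
  refine hα n ?_
  have : (2 * Real.pi * Complex.I : ℂ) ≠ 0 := Complex.two_pi_I_ne_zero
  exact mul_left_cancel₀ this (by rw [hn]; ring)

theorem isBigO_cutPow_of_re_nonneg {α : ℂ} (hα : 0 ≤ α.re) :
    cutPow α =O[𝓝[cutPlane] 0] (fun _ : ℂ => (1 : ℝ)) := by
  refine Asymptotics.IsBigO.of_bound (Real.exp (|α.im| * (2 * Real.pi))) ?_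
  filter_upwards [self_mem_nhdsWithin, nhdsWithin_le_nhds (Metric.ball_mem_nhds (0 : ℂ) one_pos)]
    with z hz hz1
  rw [mem_ball_zero_iff] at hz1
  refine (norm_cutPow_le α (ne_zero_of_mem_cutPlane hz)).trans ?_
  rw [norm_one]
  gcongr
  exact Real.rpow_le_one (norm_nonneg _) hz1.le hα

/-! ### Uniqueness -/

theorem AnalyticAt.isBigO_one_nhdsWithin {f : ℂ → ℂ} {s : Set ℂ} (hf : AnalyticAt ℂ f 0) :
    f =O[𝓝[s] 0] (fun _ : ℂ => (1 : ℝ)) :=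
  (hf.continuousAt.tendsto.isBigO_one ℝ).mono nhdsWithin_le_nhds

/-- If `z^α g(z)` is bounded along the positive axis near `0`, it is bounded near `0`. -/
theorem isBigO_cutPow_mul_of_bounded {α : ℂ} {g : ℂ → ℂ} (hg : AnalyticAt ℂ g 0) {C : ℝ}
    (hC : ∀ᶠ x : ℝ in 𝓝[>] 0, x ^ α.re * ‖g (x : ℂ)‖ ≤ C) :
    (fun z => cutPow α z * g z) =O[𝓝[cutPlane] 0] (fun _ : ℂ => (1 : ℝ)) := by
  by_cases h0 : ∀ᶠ z in 𝓝 (0 : ℂ), g z = 0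
  · refine Asymptotics.IsBigO.of_bound 1 ?_
    filter_upwards [nhdsWithin_le_nhds h0] with z hz
    simp [hz]
  · obtain ⟨m, g₁, hg₁, hne, heq⟩ := hg.exists_eventuallyEq_pow_smul_nonzero_iff.2 h0
    simp only [sub_zero, smul_eq_mul] at heq
    have hofReal : Tendsto (fun x : ℝ => (x : ℂ)) (𝓝[>] 0) (𝓝 0) := by
      have := (Complex.continuous_ofReal.tendsto (0 : ℝ)).mono_left
        (nhdsWithin_le_nhds (s := Ioi 0))
      simpa using this
    -- With `m` the order of vanishing of `g` at `0`, a negative `Re α + m` would make `x^(Re α)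
    -- |g(x)|` blow up on the positive axis.
    have hre : 0 ≤ α.re + m := by
      by_contra! hneg
      have h1 : Tendsto (fun x : ℝ => x ^ (α.re + m)) (𝓝[>] 0) atTop :=
        tendsto_rpow_neg_nhdsGT_zero hneg
      have h2 := h1.atTop_mul_pos (norm_pos_iff.2 hne)
        (hg₁.continuousAt.tendsto.comp hofReal).norm
      obtain ⟨x, h3, h4, h5, hx⟩ := ((h2.eventually_gt_atTop C).and (hC.and
        ((hofReal.eventually heq).and self_mem_nhdsWithin))).exists
      have hx : 0 < x := hx
      rw [h5, norm_mul, norm_pow, Complex.norm_real, Real.norm_of_nonneg hx.le, ← mul_assoc,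
        ← Real.rpow_natCast, ← Real.rpow_add hx] at h4
      exact absurd h3 (not_lt.2 h4)
    have hb : (fun z : ℂ => cutPow α z * z ^ m) =O[𝓝[cutPlane] 0] (fun _ : ℂ => (1 : ℝ)) := by
      refine Asymptotics.IsBigO.of_bound (Real.exp (|α.im| * (2 * Real.pi))) ?_
      filter_upwards [self_mem_nhdsWithin,
        nhdsWithin_le_nhds (Metric.ball_mem_nhds (0 : ℂ) one_pos)] with z hz hz1
      rw [mem_ball_zero_iff] at hz1
      have hz0 := ne_zero_of_mem_cutPlane hz
      rw [norm_one, norm_mul, norm_pow]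
      calc ‖cutPow α z‖ * ‖z‖ ^ m
          ≤ (Real.exp (|α.im| * (2 * Real.pi)) * ‖z‖ ^ α.re) * ‖z‖ ^ m := by
            gcongr
            exact norm_cutPow_le α hz0
        _ = Real.exp (|α.im| * (2 * Real.pi)) * ‖z‖ ^ (α.re + m) := by
            rw [Real.rpow_add (norm_pos_iff.2 hz0), Real.rpow_natCast, mul_assoc]
        _ ≤ _ := by
            gcongr
            exact Real.rpow_le_one (norm_nonneg _) hz1.le hre
    have h := hb.mul (hg₁.isBigO_one_nhdsWithin (s := cutPlane))
    refine (h.congr' ?_ ?_)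
    · filter_upwards [nhdsWithin_le_nhds heq] with z hz
      rw [hz]
      ring
    · exact Eventually.of_forall fun z => by simp

/-- The homogeneous Riemann–Hilbert problem has only the trivial solution. -/
theorem eqOn_zero_of_boundary_eq {α : ℂ} (hα : ∀ n : ℕ, α ≠ -((n : ℂ) + 1)) {f : ℂ → ℂ}
    (hf : DifferentiableOn ℂ f cutPlane)
    (hlim : ∀ x : ℝ, 0 < x → ∃ c : ℂ, Tendsto f (𝓝[{z : ℂ | 0 < z.im}] (x : ℂ)) (𝓝 c) ∧
      Tendsto f (𝓝[{z : ℂ | z.im < 0}] (x : ℂ)) (𝓝 c))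
    (hinf : f =O[Bornology.cobounded ℂ ⊓ 𝓟 cutPlane] (fun z : ℂ => z⁻¹))
    {f₀ : ℂ → ℂ} (hf₀ : AnalyticAt ℂ f₀ 0)
    (hzero : (fun z => f z - cutPow α z * f₀ z) =O[𝓝[cutPlane] 0] (fun _ : ℂ => (1 : ℝ))) :
    EqOn f 0 cutPlane := by
  have hb₀ : (fun z => cutPow α z * f₀ z) =O[𝓝[cutPlane] 0] (fun _ : ℂ => (1 : ℝ)) := by
    rcases le_or_gt 0 α.re with hre | hre
    · simpa using (isBigO_cutPow_of_re_nonneg hre).mul (hf₀.isBigO_one_nhdsWithin (s := cutPlane))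
    -- An admissible exponent with `Re α < 0` is not an integer, so `e^{2πiα} ≠ 1`. As `f` has no
    -- jump, the two boundary values of `f - z^α f₀`, each at most `C` in norm, differ by `(1 - e)
    -- x^α f₀(x)`.
    · have hint : ∀ n : ℤ, α ≠ n := by
        rintro n rfl
        rw [Complex.intCast_re] at hre
        have hn : n < 0 := by exact_mod_cast hre
        obtain ⟨k, hk⟩ := Int.eq_ofNat_of_zero_le (show 0 ≤ -n - 1 by omega)
        refine hα k ?_
        rw [show n = -((k : ℤ) + 1) by omega]
        push_cast
        ring
      set e := Complex.exp (2 * Real.pi * Complex.I * α) with he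
      have he1 : 0 < ‖1 - e‖ := norm_pos_iff.2 (sub_ne_zero.2 (exp_two_pi_mul_I_mul_ne_one hint).symm)
      obtain ⟨C, hC⟩ := hzero.bound
      rw [eventually_nhdsWithin_iff, Metric.eventually_nhds_iff_ball] at hC
      obtain ⟨ε, hε, hC⟩ := hC
      refine isBigO_cutPow_mul_of_bounded hf₀ (C := 2 * C / ‖1 - e‖) ?_
      have hofReal : Tendsto (fun x : ℝ => (x : ℂ)) (𝓝[>] 0) (𝓝 0) := by
        have := (Complex.continuous_ofReal.tendsto (0 : ℝ)).mono_left
          (nhdsWithin_le_nhds (s := Ioi 0))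
        simpa using this
      filter_upwards [self_mem_nhdsWithin, hofReal (Metric.ball_mem_nhds _ hε),
        hofReal.eventually hf₀.eventually_analyticAt] with x (hx : 0 < x) hxε hxa
      obtain ⟨c, h1, h2⟩ := hlim x hx
      have hc₀ := hxa.continuousAt.tendsto
      have hball : ∀ᶠ z in 𝓝 (x : ℂ), z ∈ Metric.ball (0 : ℂ) ε := Metric.isOpen_ball.mem_nhds hxε
      have hup : ‖c - (x : ℂ) ^ α * f₀ x‖ ≤ C := by
        refine le_of_tendsto (h1.sub ((tendsto_cutPow_above α hx).mul
          (hc₀.mono_left nhdsWithin_le_nhds))).norm ?_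
        filter_upwards [self_mem_nhdsWithin, nhdsWithin_le_nhds hball] with z hz hzb
        simpa using hC z hzb (mem_cutPlane_of_im_ne_zero (ne_of_gt hz))
      have hlow : ‖c - (x : ℂ) ^ α * e * f₀ x‖ ≤ C := by
        refine le_of_tendsto (h2.sub ((tendsto_cutPow_below α hx).mul
          (hc₀.mono_left nhdsWithin_le_nhds))).norm ?_
        filter_upwards [self_mem_nhdsWithin, nhdsWithin_le_nhds hball] with z hz hzb
        simpa using hC z hzb (mem_cutPlane_of_im_ne_zero (ne_of_lt hz))
      rw [le_div_iff₀ he1, ← Complex.norm_cpow_eq_rpow_re_of_pos hx, ← norm_mul, ← norm_mul]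
      have h3 : (x : ℂ) ^ α * f₀ x * (1 - e) =
          (c - (x : ℂ) ^ α * e * f₀ x) - (c - (x : ℂ) ^ α * f₀ x) := by ring
      rw [h3]
      refine (norm_sub_le _ _).trans ?_
      linarith
  have hb : f =O[𝓝[cutPlane] 0] (fun _ : ℂ => (1 : ℝ)) := by
    simpa using hzero.add hb₀
  obtain ⟨g, hg, hfg⟩ := exists_entire_extension hf hlim hb
  obtain ⟨C, hC⟩ := hinf.bound
  rw [eventually_inf_principal,
    (Metric.hasBasis_cobounded_compl_closedBall (0 : ℂ)).eventually_iff] at hC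
  obtain ⟨R, -, hC⟩ := hC
  have hbd : ∀ z ∈ (Metric.closedBall (0 : ℂ) R)ᶜ, z ≠ 0 → ‖g z‖ ≤ C * ‖z⁻¹‖ := by
    intro z hz h0
    refine norm_le_of_forall_cutPlane (B := fun z => C * ‖z⁻¹‖) hg.continuous.continuousOn ?_
      Metric.isClosed_closedBall.isOpen_compl (fun w hw hwc => ?_) hz h0
    · exact continuousOn_const.mul (continuousOn_inv₀.norm)
    · rw [← hfg hwc]
      exact hC hw hwc
  -- The decay hypothesis now gives Liouville's theorem its input.
  have hlim0 : Tendsto g (cocompact ℂ) (𝓝 0) := by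
    rw [← Metric.cobounded_eq_cocompact]
    have h1 : Tendsto (fun z : ℂ => C * ‖z⁻¹‖) (Bornology.cobounded ℂ) (𝓝 0) := by
      simpa using (tendsto_inv₀_cobounded (α := ℂ)).norm.const_mul C
    refine squeeze_zero_norm' ?_ h1
    filter_upwards [(Metric.hasBasis_cobounded_compl_closedBall (0 : ℂ)).mem_of_mem trivial,
      Bornology.eventually_ne_cobounded 0] with z hz h0 using hbd z hz h0
  intro z hz
  rw [hfg hz]
  exact hg.apply_eq_of_tendsto_cocompact z hlim0

/-! ### Jump and decay at infinity for every admissible exponent -/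

theorem cauchyIntegral_eq_div (hα : ∀ n : ℕ, α ≠ -((n : ℂ) + 1)) (p : Polynomial ℂ) {z : ℂ}
    (hz : z ∈ cutPlane) : cauchyIntegral α p 1 z = (cauchyIntegral (α + 1) p 1 z -
      finitePart α (fun t => p.eval t * Complex.exp (-t))) / z := by
  have := ne_zero_of_mem_cutPlane hz
  rw [cauchyIntegral_add_one hα p hz 0, cauchyIntegral_zero]
  field_simp
  ring

theorem exists_tendsto_cauchyIntegral (hα : ∀ n : ℕ, α ≠ -((n : ℂ) + 1)) (p : Polynomial ℂ)
    {x : ℝ} (hx : 0 < x) : ∃ A : ℂ,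
      Tendsto (cauchyIntegral α p 1) (𝓝[{z : ℂ | 0 < z.im}] (x : ℂ))
        (𝓝 (A + Real.pi * Complex.I * ((x : ℂ) ^ α * (p.eval (x : ℂ) * Complex.exp (-x))))) ∧
      Tendsto (cauchyIntegral α p 1) (𝓝[{z : ℂ | z.im < 0}] (x : ℂ))
        (𝓝 (A - Real.pi * Complex.I * ((x : ℂ) ^ α * (p.eval (x : ℂ) * Complex.exp (-x))))) := by
  revert hα
  refine exponent_induction (P := fun α => ∃ A : ℂ,
      Tendsto (cauchyIntegral α p 1) (𝓝[{z : ℂ | 0 < z.im}] (x : ℂ))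
        (𝓝 (A + Real.pi * Complex.I * ((x : ℂ) ^ α * (p.eval (x : ℂ) * Complex.exp (-x))))) ∧
      Tendsto (cauchyIntegral α p 1) (𝓝[{z : ℂ | z.im < 0}] (x : ℂ))
        (𝓝 (A - Real.pi * Complex.I * ((x : ℂ) ^ α * (p.eval (x : ℂ) * Complex.exp (-x))))))
    (fun α h => exists_tendsto_cauchyIntegral_of_re (by linarith) p hx) ?_ α
  rintro α hα ⟨A, h1, h2⟩
  have hx0 : (x : ℂ) ≠ 0 := by exact_mod_cast hx.ne'
  have hid : Tendsto (fun z : ℂ => z) (𝓝 (x : ℂ)) (𝓝 (x : ℂ)) := tendsto_id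
  set M := finitePart α (fun t => p.eval t * Complex.exp (-t)) with hM
  refine ⟨(A - M) / x, ?_, ?_⟩
  · refine (((h1.sub_const M).div (hid.mono_left nhdsWithin_le_nhds) hx0).congr' ?_).trans_eq ?_
    · filter_upwards [self_mem_nhdsWithin] with z hz
      exact (cauchyIntegral_eq_div hα p (mem_cutPlane_of_im_ne_zero (ne_of_gt hz))).symm
    · rw [Complex.cpow_add _ _ hx0, Complex.cpow_one]
      congr 1
      field_simp
      ring
  · refine (((h2.sub_const M).div (hid.mono_left nhdsWithin_le_nhds) hx0).congr' ?_).trans_eq ?_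
    · filter_upwards [self_mem_nhdsWithin] with z hz
      exact (cauchyIntegral_eq_div hα p (mem_cutPlane_of_im_ne_zero (ne_of_lt hz))).symm
    · rw [Complex.cpow_add _ _ hx0, Complex.cpow_one]
      congr 1
      field_simp
      ring

theorem isBigO_inv_of_isBigO_one (hα : ∀ n : ℕ, α ≠ -((n : ℂ) + 1)) {p : Polynomial ℂ}
    (h : cauchyIntegral (α + 1) p 1 =O[Bornology.cobounded ℂ ⊓ 𝓟 cutPlane]
      (fun _ : ℂ => (1 : ℂ))) :
    cauchyIntegral α p 1 =O[Bornology.cobounded ℂ ⊓ 𝓟 cutPlane] (fun z : ℂ => z⁻¹) := by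
  have h1 := (h.sub (Asymptotics.isBigO_const_const
    (finitePart α (fun t => p.eval t * Complex.exp (-t))) one_ne_zero _)).mul
    (Asymptotics.isBigO_refl (fun z : ℂ => z⁻¹) (Bornology.cobounded ℂ ⊓ 𝓟 cutPlane))
  refine h1.congr' ?_ (Eventually.of_forall fun z => one_mul _)
  filter_upwards [mem_inf_of_right (mem_principal_self cutPlane)] with z hz
  rw [cauchyIntegral_eq_div hα p hz, div_eq_mul_inv]

theorem isBigO_one_cauchyIntegral (hα : ∀ n : ℕ, α ≠ -((n : ℂ) + 1)) (p : Polynomial ℂ) :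
    cauchyIntegral α p 1 =O[Bornology.cobounded ℂ ⊓ 𝓟 cutPlane] (fun _ : ℂ => (1 : ℂ)) := by
  revert hα
  refine exponent_induction (P := fun α => cauchyIntegral α p 1
    =O[Bornology.cobounded ℂ ⊓ 𝓟 cutPlane] (fun _ : ℂ => (1 : ℂ))) (fun α h => ?_)
    (fun α hα h => ?_) α
  · obtain ⟨C, hC⟩ := exists_norm_cauchyIntegral_le h p
    refine Asymptotics.IsBigO.of_bound C ?_
    filter_upwards [mem_inf_of_right (mem_principal_self cutPlane)] with z hz
    simpa using hC z hz
  · refine (isBigO_inv_of_isBigO_one hα h).trans ?_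
    exact ((tendsto_inv₀_cobounded (α := ℂ)).isBigO_one ℂ).mono inf_le_left

theorem isBigO_inv_cauchyIntegral (hα : ∀ n : ℕ, α ≠ -((n : ℂ) + 1)) (p : Polynomial ℂ) :
    cauchyIntegral α p 1 =O[Bornology.cobounded ℂ ⊓ 𝓟 cutPlane] (fun z : ℂ => z⁻¹) :=
  isBigO_inv_of_isBigO_one hα (isBigO_one_cauchyIntegral (ne_neg_succ_add_one hα) p)

/-! ### Behaviour at the origin -/

theorem isBigO_one_cauchyIntegral_zero (hα : 1 ≤ α.re) (p : Polynomial ℂ) :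
    cauchyIntegral α p 1 =O[𝓝[cutPlane] 0] (fun _ : ℂ => (1 : ℝ)) := by
  obtain ⟨C, hC⟩ := exists_norm_cauchyIntegral_le hα p
  refine Asymptotics.IsBigO.of_bound C ?_
  filter_upwards [self_mem_nhdsWithin] with z hz
  simpa using hC z hz

theorem differentiableOn_cauchyIntegral (hα : ∀ n : ℕ, α ≠ -((n : ℂ) + 1)) (p : Polynomial ℂ) :
    DifferentiableOn ℂ (cauchyIntegral α p 1) cutPlane := fun _ hz =>
  (hasDerivAt_cauchyIntegral hα p hz).differentiableAt.differentiableWithinAt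

/-- The jump of `z^α f₀` is `(1 - e) x^α f₀(x)`, that of the Cauchy integral `2πi x^α p(x) e^{-x}`.
The factor `2πi/(1 - e)` in `f₀` equates them, and the difference, bounded at `0`, is entire. -/
theorem exists_local_form_of_re (hα : 1 ≤ α.re) (hint : ∀ n : ℤ, α ≠ n) (p : Polynomial ℂ) :
    ∃ f₀ E : ℂ → ℂ, AnalyticAt ℂ f₀ 0 ∧ AnalyticAt ℂ E 0 ∧
      ∀ᶠ z in 𝓝[cutPlane] 0, cauchyIntegral α p 1 z = cutPow α z * f₀ z + E z := by
  have hα' : ∀ n : ℕ, α ≠ -((n : ℂ) + 1) := fun n h => hint (-(n + 1)) (by rw [h]; push_cast; ring)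
  set e := Complex.exp (2 * Real.pi * Complex.I * α) with he
  have he1 : 1 - e ≠ 0 := sub_ne_zero.2 (exp_two_pi_mul_I_mul_ne_one hint).symm
  set f₀ : ℂ → ℂ := fun z => 2 * Real.pi * Complex.I / (1 - e) * (p.eval z * Complex.exp (-z))
    with hf₀
  have hdf₀ : Differentiable ℂ f₀ := by
    rw [hf₀]
    fun_prop
  obtain ⟨g, hg, hfg⟩ : ∃ g : ℂ → ℂ, Differentiable ℂ g ∧
      EqOn (fun z => cauchyIntegral α p 1 z - cutPow α z * f₀ z) g cutPlane := by
    refine exists_entire_extension ?_ ?_ ?_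
    · exact (differentiableOn_cauchyIntegral hα' p).sub (DifferentiableOn.mul (fun z hz =>
        (hasDerivAt_cutPow α hz).differentiableAt.differentiableWithinAt) hdf₀.differentiableOn)
    · intro x hx
      obtain ⟨A, h1, h2⟩ := exists_tendsto_cauchyIntegral hα' p hx
      have hc := hdf₀.continuous.tendsto (x : ℂ)
      refine ⟨_, h1.sub ((tendsto_cutPow_above α hx).mul (hc.mono_left nhdsWithin_le_nhds)), ?_⟩
      refine (h2.sub ((tendsto_cutPow_below α hx).mul (hc.mono_left nhdsWithin_le_nhds))).trans_eq ?_
      rw [← he, hf₀]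
      congr 1
      field_simp
      ring
    · refine (isBigO_one_cauchyIntegral_zero hα p).sub ?_
      simpa using (isBigO_cutPow_of_re_nonneg (α := α) (by linarith)).mul
        ((hdf₀.analyticAt 0).isBigO_one_nhdsWithin (s := cutPlane))
  refine ⟨f₀, g, hdf₀.analyticAt 0, hg.analyticAt 0, ?_⟩
  filter_upwards [self_mem_nhdsWithin] with z hz
  have := hfg hz
  simp only at this
  rw [← this]
  ring

/-- For a non-integral exponent, the Cauchy transform is `z^α` times an analytic function plus an
analytic function near `0`. -/
theorem exists_local_form (hint : ∀ n : ℤ, α ≠ n) (p : Polynomial ℂ) :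
    ∃ f₀ E : ℂ → ℂ, AnalyticAt ℂ f₀ 0 ∧ AnalyticAt ℂ E 0 ∧
      ∀ᶠ z in 𝓝[cutPlane] 0, cauchyIntegral α p 1 z = cutPow α z * f₀ z + E z := by
  have hα : ∀ n : ℕ, α ≠ -((n : ℂ) + 1) := fun n h => hint (-(n + 1)) (by rw [h]; push_cast; ring)
  revert hα hint p
  -- The polynomial is quantified inside the induction, because the step uses the hypothesis for
  -- both `p` and `p' - p`.
  suffices h : ∀ α : ℂ, (∀ n : ℕ, α ≠ -((n : ℂ) + 1)) → (∀ n : ℤ, α ≠ n) → ∀ p : Polynomial ℂ,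
      ∃ f₀ E : ℂ → ℂ, AnalyticAt ℂ f₀ 0 ∧ AnalyticAt ℂ E 0 ∧
      ∀ᶠ z in 𝓝[cutPlane] 0, cauchyIntegral α p 1 z = cutPow α z * f₀ z + E z from
    fun hint p hα => h α hα hint p
  refine exponent_induction (fun α h hint p => exists_local_form_of_re h hint p) ?_
  intro α hα ih hint p
  have hint' : ∀ n : ℤ, α + 1 ≠ n := fun n h =>
    hint (n - 1) (by push_cast; linear_combination h)
  obtain ⟨f₀, E, hf₀, hE, h0⟩ := ih hint' p
  obtain ⟨f₁, E₁, hf₁, hE₁, h1⟩ := ih hint' (p.derivative - p)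
  have hα1 : α + 1 ≠ 0 := by simpa using cast_add_ne_zero hα 0
  -- Read off from `add_one_mul_cauchyIntegral` by differentiating `z^(α+1) f₀ + E` and factoring
  -- out `z^α`.
  refine ⟨fun z => (α + 1)⁻¹ * ((α + 1) * f₀ z + z * deriv f₀ z - z * f₁ z),
    fun z => (α + 1)⁻¹ * (deriv E z - E₁ z), ?_, ?_, ?_⟩
  · exact analyticAt_const.mul (((analyticAt_const.mul hf₀).add
      (analyticAt_id.mul hf₀.deriv)).sub (analyticAt_id.mul hf₁))
  · exact analyticAt_const.mul (hE.deriv.sub hE₁)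
  · filter_upwards [self_mem_nhdsWithin, eventually_eventually_nhdsWithin.2 h0, h1,
      nhdsWithin_le_nhds hf₀.eventually_analyticAt, nhdsWithin_le_nhds hE.eventually_analyticAt]
      with z hz h0z h1z hf₀z hEz
    rw [isOpen_cutPlane.nhdsWithin_eq hz] at h0z
    have hz0 := ne_zero_of_mem_cutPlane hz
    have h2 := hasDerivAt_cauchyIntegral (ne_neg_succ_add_one hα) p hz
    have h3 := (((hasDerivAt_cutPow (α + 1) hz).fun_mul hf₀z.differentiableAt.hasDerivAt).fun_add
      hEz.differentiableAt.hasDerivAt).congr_of_eventuallyEq h0z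
    have h4 := h2.unique h3
    have h5 := add_one_mul_cauchyIntegral hα p hz
    rw [h4, h1z, cutPow_add_one α hz] at h5
    refine mul_left_cancel₀ hα1 (h5.trans ?_)
    field_simp
    ring

/-! ### Solution of the Riemann–Hilbert problem -/

theorem cauchyTransform_eq (α : ℂ) (p : Polynomial ℂ) (z : ℂ) :
    cauchyTransform α p z =
      1 / (2 * (Real.pi : ℂ) * Complex.I) * cauchyIntegral α p 1 z := by
  rw [cauchyTransform, cauchyIntegral, cauchyKernelPow_one]

theorem exists_isBigO_one_sub_cutPow_mul (hα : ∀ n : ℕ, α ≠ -((n : ℂ) + 1)) (p : Polynomial ℂ)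
    (h0 : α = 0 → p.eval 0 = 0) : ∃ f₀ : ℂ → ℂ, AnalyticAt ℂ f₀ 0 ∧
    (fun z => cauchyIntegral α p 1 z - cutPow α z * f₀ z) =O[𝓝[cutPlane] 0]
      (fun _ : ℂ => (1 : ℝ)) := by
  by_cases hint : ∀ n : ℤ, α ≠ n
  · obtain ⟨f₀, E, hf₀, hE, h⟩ := exists_local_form hint p
    refine ⟨f₀, hf₀, (hE.isBigO_one_nhdsWithin (s := cutPlane)).congr' ?_ EventuallyEq.rfl⟩
    filter_upwards [h] with z hz
    rw [hz]
    ring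
  · push Not at hint
    obtain ⟨n, hn⟩ := hint
    -- At an admissible integer, necessarily nonnegative, the Cauchy integral is itself bounded and
    -- needs no correction.
    refine ⟨0, analyticAt_const, ?_⟩
    simp only [Pi.zero_apply, mul_zero, sub_zero]
    have hn0 : 0 ≤ n := by
      by_contra! hneg
      obtain ⟨k, hk⟩ := Int.eq_ofNat_of_zero_le (show 0 ≤ -n - 1 by omega)
      refine hα k ?_
      rw [hn, show n = -((k : ℤ) + 1) by omega]
      push_cast
      ring
    rcases hn0.eq_or_lt with rfl | hpos
    · have hα0 : α = 0 := by simpa using hn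
      subst hα0
      -- Since `p(0) = 0`, a factor `t` can be moved into the exponent, giving exponent `1`;
      -- otherwise a logarithm would survive at `0`.
      obtain ⟨q, rfl⟩ := Polynomial.X_dvd_iff.2
        ((Polynomial.coeff_zero_eq_eval_zero p).trans (h0 rfl))
      refine (isBigO_one_cauchyIntegral_zero (α := 0 + 1) (by simp) q).congr' ?_ EventuallyEq.rfl
      filter_upwards [self_mem_nhdsWithin] with z hz
      exact (cauchyIntegral_X_mul hα q hz 1).symm
    · refine isBigO_one_cauchyIntegral_zero ?_ p
      rw [hn, Complex.intCast_re]
      exact_mod_cast hpos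

theorem isRHSolution_cauchyTransform (hα : ∀ n : ℕ, α ≠ -((n : ℂ) + 1)) (p : Polynomial ℂ)
    (h0 : α = 0 → p.eval 0 = 0) : IsRHSolution α p (cauchyTransform α p) := by
  have hfun : cauchyTransform α p =
      fun z => 1 / (2 * (Real.pi : ℂ) * Complex.I) * cauchyIntegral α p 1 z :=
    funext (cauchyTransform_eq α p)
  have hpi : (2 * (Real.pi : ℂ) * Complex.I) ≠ 0 := Complex.two_pi_I_ne_zero
  rw [hfun]
  refine ⟨?_, fun x hx => ?_, ?_, ?_⟩
  · exact ((differentiableOn_cauchyIntegral hα p).const_mul _).analyticOnNhd isOpen_cutPlane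
  · obtain ⟨A, h1, h2⟩ := exists_tendsto_cauchyIntegral hα p hx
    refine ⟨_, _, h1.const_mul _, h2.const_mul _, ?_⟩
    have hpi' : (Real.pi : ℂ) ≠ 0 := by exact_mod_cast Real.pi_ne_zero
    have hI := Complex.I_ne_zero
    field_simp
    ring
  · exact (isBigO_inv_cauchyIntegral hα p).const_mul_left _
  · obtain ⟨f₀, hf₀, h⟩ := exists_isBigO_one_sub_cutPow_mul hα p h0
    refine ⟨fun z => 1 / (2 * (Real.pi : ℂ) * Complex.I) * f₀ z, analyticAt_const.mul hf₀, ?_⟩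
    refine (h.const_mul_left (1 / (2 * (Real.pi : ℂ) * Complex.I))).congr_left fun z => ?_
    ring

theorem IsRHSolution.eqOn (hα : ∀ n : ℕ, α ≠ -((n : ℂ) + 1)) {p : Polynomial ℂ} {f g : ℂ → ℂ}
    (hf : IsRHSolution α p f) (hg : IsRHSolution α p g) : EqOn f g cutPlane := by
  obtain ⟨f₀, hf₀, hf0⟩ := hf.at_zero
  obtain ⟨g₀, hg₀, hg0⟩ := hg.at_zero
  have h := eqOn_zero_of_boundary_eq (f := fun z => f z - g z) hα
    (hf.analytic.differentiableOn.sub hg.analytic.differentiableOn) ?_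
    (hf.at_infinity.sub hg.at_infinity) (hf₀.fun_sub hg₀) ?_
  · intro z hz
    exact sub_eq_zero.1 (h hz)
  · intro x hx
    obtain ⟨fp, fm, h1, h2, h3⟩ := hf.jump x hx
    obtain ⟨gp, gm, h4, h5, h6⟩ := hg.jump x hx
    refine ⟨fp - gp, h1.sub h4, (h2.sub h5).trans_eq ?_⟩
    rw [h3, h6]
    congr 1
    ring
  · refine (hf0.sub hg0).congr_left fun z => ?_
    ring

theorem theorem2p4 (α : ℂ) (hα : ∀ n : ℕ, α ≠ -((n : ℂ) + 1)) (p : Polynomial ℂ)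
    (h0 : α = 0 → p.eval 0 = 0) :
    (∀ z ∈ cutPlane, HasFinitePart α (cauchyKernel p z) (finitePart α (cauchyKernel p z))) ∧
    IsRHSolution α p (cauchyTransform α p) ∧
    ∀ f : ℂ → ℂ, IsRHSolution α p f → Set.EqOn f (cauchyTransform α p) cutPlane :=
  ⟨fun _ hz => (finitePartIntegrable_cauchyKernel α p hz).hasFinitePart hα,
    isRHSolution_cauchyTransform hα p h0,
    fun _ hf => hf.eqOn hα (isRHSolution_cauchyTransform hα p h0)⟩
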